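/- For $s\in\mathbb C$ let $\xi(s)=(s-1)\,\pi^{-s/2}\,\zeta(s)\,\Gamma(1+s/2)$, and for real $c,v$ put $$M(c,s,v)=\frac{-\tfrac12(2s-1)^2+2iv-2(c+\tfrac54)}{-\tfrac14(2s-1)^2+2i\bigl(2iv-4(c+\tfrac54)\bigr)v+4(c+\tfrac54)^2},$$ $$J(s,c)=\int_{-\infty}^{\infty}\pi^{c-iv}\,\zeta(-2c+2iv-2)\,\Gamma(-c+iv)\,M(c,s,v)\,dv .$$ On the line $c=-3/2$ the integrand of $J$ has a pole at $v=0$, coming from the zeta factor. Let half the residue of this fixed pole be assigned there, that is, read $J(s,-3/2)$ as the Cauchy principal value at $v=0$ (limit as $\varepsilon\to0^+$ of the absolutely convergent integrals over $|v|>\varepsilon$). (1) For all $s$ with $0<\Re s<1$, this principal value exists and $$\xi(s)=\frac{\pi^{1/4}}{2\,\Gamma(3/4)}-\frac12-J(s,-3/2).$$ (2) (The case $s=1/2$.) The following two real integrals converge absolutely, and $$\frac1{2\pi}\int_{-\infty}^{\infty}\Im\!\left(\frac{\xi(1+2iv)}{(2iv+\frac12)\,v}\right)dv=\int_{-\infty}^{\infty}\Re\!\left(\frac{\pi^{-3/2-iv}\,\zeta(1+2iv)\,\Gamma(\tfrac32+iv)}{2iv+\frac12}\right)dv=\frac{\zeta(1/2)\,\pi^{3/4}\sqrt2}{8\,\Gamma(3/4)}+\frac{\pi^{1/4}}{2\,\Gamma(3/4)}-\frac12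 .$$ (3) (The critical line.) For every real $t$ the following integral converges absolutely, and $$\xi(\tfrac12+it)=-\frac1{2\pi^{3/2}}\int_{-\infty}^{\infty}\Re\!\left(\frac{\pi^{-iv}\,\zeta(1+2iv)\,(4t^2+4iv+1)\,\Gamma(\tfrac32+iv)}{t^2+2iv-4v^2+\frac14}\right)dv-\frac12+\frac{\pi^{1/4}}{2\,\Gamma(3/4)} .$$ -/

import Mathlib

open Filter Topology MeasureTheory

noncomputable section

/-- Riemann's function `ξ(s) = (s - 1) π^(-s/2) ζ(s) Γ(1 + s/2)`. (The formula has removable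
singularities at `s = 1` and `s = -2, -4, …`; the value there is the conventional one of the
right-hand side. Below, `ξ` is used only in the open strip `0 < Re s < 1` and, under an integral,
on the line `Re s = 1`, where the single point `s = 1` is a null set.) -/
def riemannXi (s : ℂ) : ℂ :=
  (s - 1) * (Real.pi : ℂ) ^ (-s / 2) * riemannZeta s * Complex.Gamma (1 + s / 2)

/-- The transfer function `M(c, s, v)`. -/
def transferM (c : ℝ) (s : ℂ) (v : ℝ) : ℂ :=
  (-(2 * s - 1) ^ 2 / 2 + 2 * Complex.I * v - 2 * ((c : ℂ) + 5 / 4)) /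
    (-(2 * s - 1) ^ 2 / 4 + 2 * Complex.I * (2 * Complex.I * v - 4 * ((c : ℂ) + 5 / 4)) * v
      + 4 * ((c : ℂ) + 5 / 4) ^ 2)

/-- The integrand of `J(s, c)`, on the vertical line with abscissa `c`:
`π^(c - iv) ζ(-2c + 2iv - 2) Γ(-c + iv) M(c, s, v)`. -/
def integrandJ (s : ℂ) (c : ℝ) (v : ℝ) : ℂ :=
  (Real.pi : ℂ) ^ ((c : ℂ) - Complex.I * v) *
    riemannZeta (-2 * (c : ℂ) + 2 * Complex.I * v - 2) *
    Complex.Gamma (-(c : ℂ) + Complex.I * v) * transferM c s v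

/-- `J(s, -3/2) = L`, where the fixed pole (the pole of the zeta factor, at `v = 0` on the line
`c = -3/2`) is counted with half its residue: the integral converges absolutely away from the
pole, and its Cauchy principal value at the pole is `L`. -/
def HasHalfResidueJ (s L : ℂ) : Prop :=
  (∀ ε : ℝ, 0 < ε → IntegrableOn (integrandJ s (-3 / 2)) {v : ℝ | ε < |v|}) ∧
    Tendsto (fun ε : ℝ => ∫ v in {v : ℝ | ε < |v|}, integrandJ s (-3 / 2) v)
      (𝓝[>] 0) (𝓝 L)

/-- `Im (ξ(1 + 2iv) / ((2iv + 1/2) v))`. -/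
def xiIntegrand (v : ℝ) : ℝ :=
  (riemannXi (1 + 2 * Complex.I * v) / ((2 * Complex.I * v + 1 / 2) * v)).im

/-- `Re (π^(-3/2 - iv) ζ(1 + 2iv) Γ(3/2 + iv) / (2iv + 1/2))`. -/
def zetaIntegrand (v : ℝ) : ℝ :=
  ((Real.pi : ℂ) ^ (-3 / 2 - Complex.I * v) * riemannZeta (1 + 2 * Complex.I * v) *
    Complex.Gamma (3 / 2 + Complex.I * v) / (2 * Complex.I * v + 1 / 2)).re

/-- `Re (π^(-iv) ζ(1 + 2iv) (4t² + 4iv + 1) Γ(3/2 + iv) / (t² + 2iv - 4v² + 1/4))`. -/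
def criticalIntegrand (t v : ℝ) : ℝ :=
  ((Real.pi : ℂ) ^ (-(Complex.I * v)) * riemannZeta (1 + 2 * Complex.I * v) *
    (4 * (t : ℂ) ^ 2 + 4 * Complex.I * v + 1) * Complex.Gamma (3 / 2 + Complex.I * v) /
      ((t : ℂ) ^ 2 + 2 * Complex.I * v - 4 * (v : ℂ) ^ 2 + 1 / 4)).re

end

/-! Put `w = 1 + 2iv`. On `c = -3/2` the zeta, gamma and `π` factors of the integrand combine to
`ξ(w) / (π (w - 1))`, and partial fractions of the transfer function give `(1/π) ξ(w) (2/(w - 1) -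
1/(w - s) - 1/(w - (1 - s)))`. Thus `J` is a combination of Cauchy integrals of the entire `ξ` along
`Re w = 1`.

The last two terms yield `-ξ(s)`: moved to `Re w = 1/2`, the regularized quotients cancel under `w ↦
1 - w` by `ξ(1 - w) = ξ(w)`, and only their subtracted poles contribute
(`integral_regXi_add_regXi_one_sub`, `integral_poleKernel`). The first term does not involve `s`.
Moving it to `Re w = 3/2` costs half a residue, the `-1/2`; there `ξ(w)/(w - 1)` is a Dirichlet
series times `Γ(1 + w/2)`, and termwise Cahen–Mellin inversion leaves `∑ n² exp(-π n²)`, which the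
theta functional equation differentiated at its fixed point expresses through `θ₃(1)`
(`integral_entireXi_div`). These shifts rest on the decay of `ξ` in strips (`entireXi_decay`).

The value `θ₃(1) = π^(1/4)/Γ(3/4)` comes from Gauss: doubling `y` performs one arithmetic-geometric
step on `(θ₃², θ₄²)`, both tend to `1`, and at `y = 1` their ratio is `√2`, so the invariant
integral is a lemniscate integral, hence a beta value.

The singular part of the integrand at `v = 0` is odd and purely imaginary. Oddness gives the
principal value; taking real parts removes the singularity and gives the convergent integrals of (2)
and (3), since `ξ` is real on the critical line. -/

/-! ### Decay of `Γ` and `ξ` on vertical lines -/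

/-- The norm of `Γ` decays faster than any power of `‖s‖` on vertical lines. -/
lemma norm_pow_mul_norm_Gamma_le {s : ℂ} (hs : 0 < s.re) (m : ℕ) :
    ‖s‖ ^ m * ‖Complex.Gamma s‖ ≤ Real.Gamma (s.re + m) := by
  induction m generalizing s with
  | zero =>
    rw [Complex.Gamma_eq_integral hs, Complex.GammaIntegral, pow_zero, one_mul, Nat.cast_zero,
      add_zero, Real.Gamma_eq_integral hs]
    refine (norm_integral_le_integral_norm _).trans_eq ?_
    refine setIntegral_congr_fun measurableSet_Ioi fun x hx => ?_
    have hx : 0 < x := hx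
    simp [Complex.norm_cpow_eq_rpow_re_of_pos hx, Complex.norm_exp]
  | succ m ih =>
    have hs0 : s ≠ 0 := by rintro rfl; simp at hs
    have h1 := ih (s := s + 1) (by simp; linarith)
    rw [Complex.Gamma_add_one _ hs0, norm_mul] at h1
    have h2 : ‖s‖ ≤ ‖s + 1‖ := by
      rw [← sq_le_sq₀ (norm_nonneg _) (norm_nonneg _), Complex.sq_norm, Complex.sq_norm]
      simp only [Complex.normSq_apply, Complex.add_re, Complex.one_re, Complex.add_im,
        Complex.one_im]
      nlinarith
    calc ‖s‖ ^ (m + 1) * ‖Complex.Gamma s‖ = ‖s‖ ^ m * (‖s‖ * ‖Complex.Gamma s‖) := by ring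
      _ ≤ ‖s + 1‖ ^ m * (‖s‖ * ‖Complex.Gamma s‖) := by gcongr
      _ ≤ _ := h1
      _ = _ := by push_cast; congr 1; simp; ring

/-- On a strip `t^(σ - 1) ≤ t^(a - 1) + t^(b - 1)`, so a single integrable majorant serves every
`s`. -/
lemma norm_mellin_le {F : ℝ → ℂ} (hF : ∀ s : ℂ, MellinConvergent F s) (a b : ℝ) :
    ∃ M : ℝ, ∀ s : ℂ, a ≤ s.re → s.re ≤ b → ‖mellin F s‖ ≤ M := by
  have hint : ∀ c : ℝ, IntegrableOn (fun t : ℝ => t ^ (c - 1) * ‖F t‖) (Set.Ioi 0) := by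
    intro c
    refine IntegrableOn.congr_fun (Integrable.norm (hF c)) (fun t ht => ?_) measurableSet_Ioi
    have ht : 0 < t := ht
    simp [Complex.norm_cpow_eq_rpow_re_of_pos ht]
  refine ⟨∫ t in Set.Ioi (0 : ℝ), (t ^ (a - 1) * ‖F t‖ + t ^ (b - 1) * ‖F t‖), fun s ha hb => ?_⟩
  refine norm_integral_le_of_norm_le ((hint a).add (hint b)) ?_
  filter_upwards [ae_restrict_mem measurableSet_Ioi] with t ht
  have ht : 0 < t := ht
  rw [norm_smul, Complex.norm_cpow_eq_rpow_re_of_pos ht, ← add_mul]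
  gcongr
  simp only [Complex.sub_re, Complex.one_re]
  rcases le_total t 1 with h | h
  · have := Real.rpow_le_rpow_of_exponent_ge ht h (show a - 1 ≤ s.re - 1 by linarith)
    have := Real.rpow_nonneg ht.le (b - 1)
    linarith
  · have := Real.rpow_le_rpow_of_exponent_le h (show s.re - 1 ≤ b - 1 by linarith)
    have := Real.rpow_nonneg ht.le (a - 1)
    linarith

/-- `Λ₀` is a Mellin transform that converges on the whole plane. This supplies the a priori growth
bound for Phragmén–Lindelöf. -/
lemma norm_completedRiemannZeta₀_le (a b : ℝ) :
    ∃ M : ℝ, ∀ s : ℂ, a ≤ s.re → s.re ≤ b → ‖completedRiemannZeta₀ s‖ ≤ M := by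
  obtain ⟨M, hM⟩ := norm_mellin_le (F := (HurwitzZeta.hurwitzEvenFEPair 0).f_modif)
    (fun s => ((HurwitzZeta.hurwitzEvenFEPair 0).isStrongFEPair_toStrongFEPair.hasMellin s).1)
    (a / 2) (b / 2)
  refine ⟨M, fun s ha hb => ?_⟩
  have h2 : (s / 2).re = s.re / 2 := by simp
  have := hM (s / 2) (by rw [h2]; linarith) (by rw [h2]; linarith)
  have h : completedRiemannZeta₀ s =
    mellin (HurwitzZeta.hurwitzEvenFEPair 0).f_modif (s / 2) / 2 := rfl
  rw [h, norm_div]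
  have := norm_nonneg (mellin (HurwitzZeta.hurwitzEvenFEPair 0).f_modif (s / 2))
  norm_num
  linarith

noncomputable section

/-- The entire continuation of Riemann's function `ξ`. -/
def entireXi (w : ℂ) : ℂ := 1 / 2 + w * (w - 1) / 2 * completedRiemannZeta₀ w

lemma differentiable_entireXi : Differentiable ℂ entireXi := by
  unfold entireXi
  have := differentiable_completedZeta₀
  fun_prop

lemma entireXi_one_sub (w : ℂ) : entireXi (1 - w) = entireXi w := by
  rw [entireXi, entireXi, completedRiemannZeta₀_one_sub]; ring

lemma entireXi_one : entireXi 1 = 1 / 2 := by simp [entireXi]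

/-- The polar terms `-1/w - 1/(1 - w)` of the completed zeta function, times `w (w - 1)/2`, become
the constant `1/2`. The point `w = 1` must be excluded: there the product formula gives `0`, the
continuation `1/2`. -/
lemma riemannXi_eq_entireXi {w : ℂ} (hw : 0 < w.re) (h1 : w ≠ 1) :
    riemannXi w = entireXi w := by
  have h0 : w ≠ 0 := by rintro rfl; simp at hw
  have hG : Complex.Gamma (1 + w / 2) ≠ 0 := Complex.Gamma_ne_zero_of_re_pos (by simp; linarith)
  have hpi : (Real.pi : ℂ) ^ (-w / 2) ≠ 0 := by simp [Complex.cpow_eq_zero_iff, Real.pi_ne_zero]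
  have h2 : w - 1 ≠ 0 := sub_ne_zero.2 h1
  have h3 : 1 - w ≠ 0 := sub_ne_zero.2 h1.symm
  rw [riemannXi, riemannZeta_eq_mul_completedRiemannZeta₀, add_comm (w / 2) 1, entireXi]
  generalize Complex.Gamma (1 + w / 2) = G at *
  field_simp
  ring

/-- `ξ` decays at least quadratically in vertical strips. -/
lemma entireXi_decay : ∃ C : ℝ, 0 ≤ C ∧ ∀ w : ℂ, -1 ≤ w.re → w.re ≤ 2 →
    w.im ^ 2 * ‖entireXi w‖ ≤ C := by
  set f : ℂ → ℂ := fun w => w * (w - 1) * entireXi w with hf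
  obtain ⟨M, hM⟩ := norm_completedRiemannZeta₀_le (-1) 2
  have hM0 : 0 ≤ M := (norm_nonneg _).trans (hM 0 (by simp) (by simp))
  have hsymm : ∀ w, f (1 - w) = f w := fun w => by
    simp only [hf, entireXi_one_sub]; ring
  have hpoly : ∀ w : ℂ, -1 ≤ w.re → w.re ≤ 2 →
      ‖f w‖ ≤ (2 + 8 * M) * Real.exp (4 * Real.exp (1 * |w.im|)) := by
    intro w h1 h2
    set E := Real.exp |w.im|
    have hE : |w.im| + 1 ≤ E := Real.add_one_le_exp _
    have hE1 : 1 ≤ E := Real.one_le_exp (abs_nonneg _)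
    have a1 : ‖w‖ ≤ 2 * E := by
      refine (Complex.norm_le_abs_re_add_abs_im w).trans ?_
      have : |w.re| ≤ 2 := abs_le.2 ⟨by linarith, h2⟩
      linarith [abs_nonneg w.im]
    have a2 : ‖w - 1‖ ≤ 2 * E := by
      refine (Complex.norm_le_abs_re_add_abs_im _).trans ?_
      have : |(w - 1).re| ≤ 2 := by
        simp only [Complex.sub_re, Complex.one_re]; exact abs_le.2 ⟨by linarith, by linarith⟩
      have h3 : (w - 1).im = w.im := by simp
      rw [h3]
      linarith [abs_nonneg w.im]
    have a3 : ‖entireXi w‖ ≤ 1 / 2 + (2 * E) * (2 * E) / 2 * M := by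
      refine (norm_add_le _ _).trans ?_
      simp only [norm_mul, norm_div, norm_one, Complex.norm_ofNat]
      gcongr
      exact hM w h1 h2
    have a4 : ‖f w‖ ≤ (2 * E) * (2 * E) * (1 / 2 + (2 * E) * (2 * E) / 2 * M) := by
      simp only [hf, norm_mul]
      gcongr
    have a5 : E ^ 4 ≤ Real.exp (4 * Real.exp (1 * |w.im|)) := by
      rw [one_mul, ← Real.exp_nat_mul]
      apply Real.exp_le_exp.2
      push_cast
      linarith
    have hE2 : E ^ 2 ≤ E ^ 4 := pow_le_pow_right₀ hE1 (by norm_num)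
    calc ‖f w‖ ≤ 2 * E ^ 2 + 8 * M * E ^ 4 := by linarith
      _ ≤ (2 + 8 * M) * E ^ 4 := by linarith
      _ ≤ _ := by gcongr
  obtain ⟨C, hC⟩ : ∃ C : ℝ, ∀ w : ℂ, w.re = 2 → ‖f w‖ ≤ C := by
    -- `8 = 2³`: the factors `w`, `w - 1`, `w - 1` are each at most `2‖s‖` with `s = 1 + w/2`, and
    -- `Γ(s)` absorbs `‖s‖³`.
    refine ⟨8 * ((∑' n : ℕ, 1 / (n : ℝ) ^ (2 : ℝ)) * Real.Gamma (2 + 3)), fun w hw => ?_⟩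
    have hw1 : w ≠ 1 := by rintro rfl; simp at hw
    set s := 1 + w / 2 with hs
    have hsre : s.re = 2 := by simp [hs, hw]; norm_num
    have b0 : ∀ (z : ℂ), 1 ≤ z.re → ‖z - 1‖ ≤ ‖z‖ := by
      intro z hz
      rw [← sq_le_sq₀ (norm_nonneg _) (norm_nonneg _), Complex.sq_norm, Complex.sq_norm]
      simp only [Complex.normSq_apply, Complex.sub_re, Complex.one_re, Complex.sub_im,
        Complex.one_im]
      nlinarith
    have b1 : ‖w‖ ≤ 2 * ‖s‖ := by
      have : w = 2 * (s - 1) := by rw [hs]; ring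
      rw [this, norm_mul]
      have := b0 s (by linarith)
      simpa using this
    have b2 : ‖w - 1‖ ≤ 2 * ‖s‖ := (b0 w (by linarith)).trans b1
    have b3 : ‖riemannZeta w‖ ≤ ∑' n : ℕ, 1 / (n : ℝ) ^ (2 : ℝ) := by
      rw [zeta_eq_tsum_one_div_nat_cpow (by linarith)]
      have hsum : Summable fun n : ℕ => 1 / (n : ℝ) ^ (2 : ℝ) :=
        Real.summable_one_div_nat_rpow.2 (by norm_num)
      refine tsum_of_norm_bounded hsum.hasSum fun n => ?_
      rw [norm_div, norm_one, Complex.norm_natCast_cpow_of_re_ne_zero _ (by rw [hw]; norm_num), hw]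
    have b4 : ‖(Real.pi : ℂ) ^ (-w / 2)‖ ≤ 1 := by
      rw [Complex.norm_cpow_eq_rpow_re_of_pos Real.pi_pos]
      apply Real.rpow_le_one_of_one_le_of_nonpos
      · linarith [Real.pi_gt_three]
      · simp [hw]
    have b5 := norm_pow_mul_norm_Gamma_le (s := s) (by linarith) 3
    rw [hsre] at b5
    have hZ : 0 ≤ ∑' n : ℕ, 1 / (n : ℝ) ^ (2 : ℝ) := (norm_nonneg _).trans b3
    simp only [hf]
    rw [← riemannXi_eq_entireXi (by linarith) hw1, riemannXi, ← hs]
    simp only [norm_mul]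
    calc ‖w‖ * ‖w - 1‖ * (‖w - 1‖ * ‖(Real.pi : ℂ) ^ (-w / 2)‖ * ‖riemannZeta w‖ *
          ‖Complex.Gamma s‖)
        ≤ (2 * ‖s‖) * (2 * ‖s‖) * ((2 * ‖s‖) * 1 * (∑' n : ℕ, 1 / (n : ℝ) ^ (2 : ℝ)) *
          ‖Complex.Gamma s‖) := by gcongr
      _ = 8 * ((∑' n : ℕ, 1 / (n : ℝ) ^ (2 : ℝ)) * (‖s‖ ^ 3 * ‖Complex.Gamma s‖)) := by ring
      _ ≤ _ := by
        have : ‖s‖ ^ 3 * ‖Complex.Gamma s‖ ≤ Real.Gamma (2 + 3) := by exact_mod_cast b5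
        gcongr
  have hC0 : 0 ≤ C := (norm_nonneg _).trans (hC 2 (by simp))
  refine ⟨C, hC0, fun w h1 h2 => ?_⟩
  have hdf : Differentiable ℂ f := by
    have := differentiable_entireXi
    simp only [hf]; fun_prop
  have key : ‖f w‖ ≤ C := by
    -- The strip has width `3`, so growth `exp(4 exp |Im w|)` is admissible because `1 < π/3`. The
    -- left edge reduces to the right one by `w ↦ 1 - w`.
    refine PhragmenLindelof.vertical_strip (a := -1) (b := 2) hdf.diffContOnCl
      ⟨1, by rw [lt_div_iff₀] <;> linarith [Real.pi_gt_three], 4, ?_⟩ ?_ hC h1 h2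
    · refine Asymptotics.IsBigO.of_bound (2 + 8 * M) ?_
      filter_upwards [mem_inf_of_right (mem_principal_self _)] with z hz
      rw [Real.norm_eq_abs, abs_of_pos (Real.exp_pos _)]
      exact hpoly z hz.1.le hz.2.le
    · intro z hz
      rw [← hsymm]
      exact hC _ (by simp [hz]; norm_num)
  refine le_trans ?_ key
  simp only [hf, norm_mul]
  have c1 : |w.im| ≤ ‖w‖ := Complex.abs_im_le_norm w
  have c2 : |w.im| ≤ ‖w - 1‖ := by simpa using Complex.abs_im_le_norm (w - 1)
  rw [← sq_abs, sq]
  gcongr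

end

/-! ### Shifting vertical lines of integration -/

lemma integrable_of_sq_mul_norm_le {g : ℝ → ℂ} (hg : Continuous g) {C T : ℝ}
    (hC : ∀ y, T ≤ |y| → y ^ 2 * ‖g y‖ ≤ C) : Integrable g := by
  refine (hg.locallyIntegrable (μ := volume)).integrable_of_isBigO_cocompact
    (g := fun y : ℝ => (1 + y ^ 2)⁻¹) ?_
    (integrable_inv_one_add_sq.integrableAtFilter _)
  refine Asymptotics.IsBigO.of_bound (2 * C) ?_
  have h : ∀ᶠ y : ℝ in cocompact ℝ, max T 1 ≤ ‖y‖ :=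
    (tendsto_norm_cocompact_atTop (E := ℝ)).eventually_ge_atTop _
  filter_upwards [h] with y hy
  rw [Real.norm_eq_abs] at hy
  have h1 := hC y ((le_max_left _ _).trans hy)
  have h2 : 1 ≤ |y| := (le_max_right _ _).trans hy
  have h3 : 1 ≤ y ^ 2 := by rw [← sq_abs]; nlinarith
  rw [norm_inv, Real.norm_eq_abs, abs_of_pos (by positivity : (0:ℝ) < 1 + y ^ 2),
    ← div_eq_mul_inv, le_div_iff₀ (by positivity)]
  nlinarith [norm_nonneg (g y)]

/-- Shifting a vertical line of integration through a strip of holomorphy with quadratic decay. -/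
lemma integral_vertical_eq {f : ℂ → ℂ} {a b C T : ℝ} (hab : a ≤ b)
    (hd : DifferentiableOn ℂ f {w | a ≤ w.re ∧ w.re ≤ b})
    (hC : ∀ w : ℂ, a ≤ w.re → w.re ≤ b → T ≤ |w.im| → w.im ^ 2 * ‖f w‖ ≤ C) :
    Integrable (fun y : ℝ => f (a + y * Complex.I)) ∧
    Integrable (fun y : ℝ => f (b + y * Complex.I)) ∧
    ∫ y : ℝ, f (a + y * Complex.I) = ∫ y : ℝ, f (b + y * Complex.I) := by
  have hcont : ∀ c : ℝ, a ≤ c → c ≤ b → Continuous fun y : ℝ => f (c + y * Complex.I) := by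
    intro c h1 h2
    refine hd.continuousOn.comp_continuous (by fun_prop) fun y => ?_
    simp [h1, h2]
  have hint : ∀ c : ℝ, a ≤ c → c ≤ b → Integrable fun y : ℝ => f (c + y * Complex.I) := by
    intro c h1 h2
    refine integrable_of_sq_mul_norm_le (hcont c h1 h2) (C := C) (T := T) fun y hy => ?_
    simpa using hC (c + y * Complex.I) (by simpa) (by simpa) (by simpa)
  refine ⟨hint a le_rfl hab, hint b hab le_rfl, ?_⟩
  have hlim : ∀ c : ℝ, a ≤ c → c ≤ b →
      Tendsto (fun R : ℝ => ∫ y in (-R)..R, f (c + y * Complex.I)) atTop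
        (𝓝 (∫ y : ℝ, f (c + y * Complex.I))) := fun c h1 h2 =>
    intervalIntegral_tendsto_integral (hint c h1 h2) tendsto_neg_atTop_atBot tendsto_id
  have hedge : ∀ ε : ℝ, |ε| = 1 →
      Tendsto (fun R : ℝ => ∫ x in a..b, f (x + (ε * R : ℝ) * Complex.I)) atTop (𝓝 0) := by
    intro ε hε
    have h0 : Tendsto (fun R : ℝ => C / R ^ 2 * |b - a|) atTop (𝓝 0) := by
      have : Tendsto (fun R : ℝ => C / R ^ 2) atTop (𝓝 0) :=
        (tendsto_pow_atTop two_ne_zero).const_div_atTop C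
      simpa using this.mul_const (|b - a|)
    refine squeeze_zero_norm' ?_ h0
    filter_upwards [eventually_ge_atTop T, eventually_gt_atTop 0] with R hR hR0
    refine intervalIntegral.norm_integral_le_of_norm_le_const fun x hx => ?_
    rw [Set.uIoc_of_le hab] at hx
    have him : |ε * R| = R := by rw [abs_mul, hε, one_mul, abs_of_pos hR0]
    have := hC (x + (ε * R : ℝ) * Complex.I) (by simpa using hx.1.le) (by simpa using hx.2)
      (by
        rw [Complex.add_im, Complex.ofReal_im, Complex.im_ofReal_mul, Complex.I_im, zero_add, mul_one, him]
        exact hR)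
    rw [Complex.add_im, Complex.ofReal_im, Complex.im_ofReal_mul, Complex.I_im, zero_add,
      mul_one, ← sq_abs, him] at this
    rw [le_div_iff₀ (by positivity), mul_comm]
    exact this
  have hrect : ∀ᶠ R : ℝ in atTop,
      (∫ x in a..b, f (x + ((-1) * R : ℝ) * Complex.I)) -
        (∫ x in a..b, f (x + (1 * R : ℝ) * Complex.I)) +
        Complex.I • (∫ y in (-R)..R, f (b + y * Complex.I)) -
        Complex.I • (∫ y in (-R)..R, f (a + y * Complex.I)) = 0 := by
    filter_upwards [eventually_gt_atTop 0] with R hR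
    have := Complex.integral_boundary_rect_eq_zero_of_differentiableOn f ⟨a, -R⟩ ⟨b, R⟩
      (hd.mono fun w hw => by
        have := hw.1
        rw [Set.mem_preimage, Set.uIcc_of_le hab] at this
        exact this)
    simpa using this
  have h1 := ((((hedge (-1) (by simp)).sub (hedge 1 (by simp))).add
    ((hlim b hab le_rfl).const_smul Complex.I)).sub ((hlim a le_rfl hab).const_smul Complex.I))
  have h2 := tendsto_nhds_unique (h1.congr' hrect) tendsto_const_nhds
  rw [sub_zero, zero_add, ← smul_sub, smul_eq_zero] at h2
  exact (sub_eq_zero.1 (h2.resolve_left Complex.I_ne_zero)).symm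

/-! ### The model pole and its integral over a vertical line -/

lemma integral_univ_div_sq_add_sq {c : ℝ} (hc : 0 < c) :
    Integrable (fun y : ℝ => c / (c ^ 2 + y ^ 2)) ∧ ∫ y : ℝ, c / (c ^ 2 + y ^ 2) = Real.pi := by
  have h : (fun y : ℝ => c / (c ^ 2 + y ^ 2)) = fun y => c⁻¹ * (1 + (y / c) ^ 2)⁻¹ := by
    ext y; field_simp
  rw [h]
  refine ⟨(integrable_inv_one_add_sq.comp_div hc.ne').const_mul _, ?_⟩
  rw [integral_const_mul, Measure.integral_comp_div (fun y : ℝ => (1 + y ^ 2)⁻¹),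
    integral_univ_inv_one_add_sq, abs_of_pos hc, smul_eq_mul]
  field_simp

noncomputable section

/-- A model for a simple pole at `0` with residue `1`, decaying cubically on vertical lines. -/
def poleKernel (z : ℂ) : ℂ := 1 / (z * (1 - z ^ 2))

end

lemma poleKernel_neg (z : ℂ) : poleKernel (-z) = -poleKernel z := by
  simp only [poleKernel, neg_mul, div_neg, even_two.neg_pow]

lemma sq_mul_norm_poleKernel_le {z : ℂ} (hz : 1 ≤ |z.im|) :
    |z.im| ^ 2 * ‖poleKernel z‖ ≤ 1 := by
  have h1 : |z.im| ≤ ‖z‖ := Complex.abs_im_le_norm z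
  have h2 : |z.im| ≤ ‖1 - z‖ := by simpa using Complex.abs_im_le_norm (1 - z)
  have h3 : |z.im| ≤ ‖1 + z‖ := by simpa using Complex.abs_im_le_norm (1 + z)
  have h4 : (1 - z ^ 2) = (1 - z) * (1 + z) := by ring
  rw [poleKernel, norm_div, norm_one, mul_one_div, div_le_one, h4, norm_mul, norm_mul, sq]
  · calc |z.im| * |z.im| = 1 * (|z.im| * |z.im|) := by ring
      _ ≤ ‖z‖ * (‖1 - z‖ * ‖1 + z‖) := by gcongr; linarith
  · rw [h4]
    simp only [norm_mul]
    have : 0 < |z.im| := by linarith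
    have := this.trans_le h1
    have : 0 < ‖1 - z‖ := by linarith
    have : 0 < ‖1 + z‖ := by linarith
    positivity

lemma one_sub_sq_ne_zero_of_abs_re_lt {z : ℂ} (h1 : |z.re| < 1) : 1 - z ^ 2 ≠ 0 := by
  intro h
  have : (z - 1) * (z + 1) = 0 := by linear_combination -h
  rcases mul_eq_zero.1 this with h | h
  · rw [sub_eq_zero.1 h] at h1; simp at h1
  · rw [eq_neg_of_add_eq_zero_left h] at h1; simp at h1

lemma differentiableAt_poleKernel {z : ℂ} (h0 : z.re ≠ 0) (h1 : |z.re| < 1) :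
    DifferentiableAt ℂ poleKernel z := by
  have hz : z ≠ 0 := by rintro rfl; simp at h0
  have hz2 := one_sub_sq_ne_zero_of_abs_re_lt h1
  unfold poleKernel
  fun_prop (disch := exact mul_ne_zero hz hz2)

/-- `poleKernel z = 1/z + (1/2)/(1 - z) - (1/2)/(1 + z)`. These fractions are not separately
integrable, but pairing `y` with `-y` turns each into a Poisson kernel of mass `π`; the total `2π +
π - π` counts the integral twice. -/
lemma integral_poleKernel {a : ℝ} (h0 : 0 < a) (h1 : a < 1) :
    Integrable (fun y : ℝ => poleKernel (a + y * Complex.I)) ∧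
      ∫ y : ℝ, poleKernel (a + y * Complex.I) = Real.pi := by
  have hint : Integrable (fun y : ℝ => poleKernel (a + y * Complex.I)) := by
    refine integrable_of_sq_mul_norm_le (C := 1) (T := 1) ?_ fun y hy => ?_
    · refine continuous_iff_continuousAt.2 fun y => ?_
      have := (differentiableAt_poleKernel (z := a + y * Complex.I) (by simpa using h0.ne')
        (by simpa [abs_of_pos h0] using h1)).continuousAt
      exact ContinuousAt.comp (f := fun y : ℝ => (a + y * Complex.I : ℂ)) this (by fun_prop)
    · have := sq_mul_norm_poleKernel_le (z := a + y * Complex.I) (by simpa)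
      simpa using this
  refine ⟨hint, ?_⟩
  have hpair : ∀ c y : ℝ, c ≠ 0 → (1 / (c + y * Complex.I) + 1 / (c + (-y : ℝ) * Complex.I) : ℂ)
      = 2 * ((c / (c ^ 2 + y ^ 2) : ℝ) : ℂ) := by
    intro c y hc
    have e1 : (c + y * Complex.I : ℂ) ≠ 0 := fun h => hc (by simpa using congrArg Complex.re h)
    have e2 : (c + (-y : ℝ) * Complex.I : ℂ) ≠ 0 :=
      fun h => hc (by simpa using congrArg Complex.re h)
    have e3 : ((c : ℂ) ^ 2 + (y : ℂ) ^ 2) = (c + y * Complex.I) * (c + (-y : ℝ) * Complex.I) := by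
      push_cast
      linear_combination (y : ℂ) ^ 2 * Complex.I_sq
    have e4 : (c + y * Complex.I : ℂ) + (c + (-y : ℝ) * Complex.I) = 2 * c := by push_cast; ring
    rw [Complex.ofReal_div, Complex.ofReal_add, Complex.ofReal_pow, Complex.ofReal_pow, e3]
    generalize (c + y * Complex.I : ℂ) = p at *
    generalize (c + (-y : ℝ) * Complex.I : ℂ) = q at *
    field_simp
    linear_combination e4
  have hsplit : ∀ y : ℝ, poleKernel (a + y * Complex.I) = 1 / ((a : ℝ) + y * Complex.I)
      + 1 / 2 * (1 / (((1 - a : ℝ) : ℂ) + (-y : ℝ) * Complex.I))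
      - 1 / 2 * (1 / (((1 + a : ℝ) : ℂ) + y * Complex.I)) := by
    intro y
    have e1 : (a + y * Complex.I : ℂ) ≠ 0 :=
      fun h => h0.ne' (by simpa using congrArg Complex.re h)
    have e2 : (((1 - a : ℝ) : ℂ) + (-y : ℝ) * Complex.I : ℂ) ≠ 0 := fun h => by
      have := congrArg Complex.re h
      simp at this; linarith
    have e3 : (((1 + a : ℝ) : ℂ) + y * Complex.I : ℂ) ≠ 0 := fun h => by
      have := congrArg Complex.re h
      simp at this; linarith
    have e4 : (((1 - a : ℝ) : ℂ) + (-y : ℝ) * Complex.I) = 1 - (a + y * Complex.I) := by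
      push_cast; ring
    have e5 : (((1 + a : ℝ) : ℂ) + y * Complex.I) = 1 + (a + y * Complex.I) := by
      push_cast; ring
    rw [e4] at e2 ⊢
    rw [e5] at e3 ⊢
    rw [poleKernel]
    generalize (a + y * Complex.I : ℂ) = z at *
    have e6 : 1 - z ^ 2 = (1 - z) * (1 + z) := by ring
    rw [e6]
    field_simp
    ring
  have hsum : ∀ y : ℝ, poleKernel (a + y * Complex.I) + poleKernel (a + (-y : ℝ) * Complex.I) =
      ((2 * (a / (a ^ 2 + y ^ 2)) + (1 - a) / ((1 - a) ^ 2 + y ^ 2)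
        - (1 + a) / ((1 + a) ^ 2 + y ^ 2) : ℝ) : ℂ) := by
    intro y
    have p1 := hpair a y h0.ne'
    have p2 := hpair (1 - a) y (by linarith)
    have p3 := hpair (1 + a) y (by linarith)
    rw [hsplit, hsplit, neg_neg]
    push_cast at p1 p2 p3 ⊢
    linear_combination p1 + 1 / 2 * p2 - 1 / 2 * p3
  obtain ⟨i1, v1⟩ := integral_univ_div_sq_add_sq h0
  obtain ⟨i2, v2⟩ := integral_univ_div_sq_add_sq (c := 1 - a) (by linarith)
  obtain ⟨i3, v3⟩ := integral_univ_div_sq_add_sq (c := 1 + a) (by linarith)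
  have hneg : ∫ y : ℝ, poleKernel (a + (-y : ℝ) * Complex.I) =
      ∫ y : ℝ, poleKernel (a + y * Complex.I) :=
    integral_neg_eq_self (fun y : ℝ => poleKernel (a + y * Complex.I)) volume
  have htot : (∫ y : ℝ, poleKernel (a + y * Complex.I)) +
      ∫ y : ℝ, poleKernel (a + (-y : ℝ) * Complex.I) = 2 * Real.pi := by
    rw [← integral_add hint hint.comp_neg]
    simp_rw [hsum]
    have i12 : Integrable fun y : ℝ =>
      2 * (a / (a ^ 2 + y ^ 2)) + (1 - a) / ((1 - a) ^ 2 + y ^ 2) := (i1.const_mul 2).add i2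
    rw [integral_complex_ofReal, integral_sub i12 i3,
      integral_add (i1.const_mul 2) i2, integral_const_mul, v1, v2, v3]
    push_cast
    ring
  rw [hneg] at htot
  linear_combination htot / 2

/-! ### Regularized quotients `ξ(w)/(w - s)` -/

noncomputable section

/-- The regularization `ξ(w) / (w - s) - ξ(s) poleKernel (w - s)`, holomorphic near `s`. -/
def regXi (s : ℂ) : ℂ → ℂ :=
  dslope (fun w => entireXi w - entireXi s / (1 - (w - s) ^ 2)) s

end

lemma regXi_eq {s w : ℂ} (h : w ≠ s) :
    regXi s w = entireXi w / (w - s) - entireXi s * poleKernel (w - s) := by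
  have : w - s ≠ 0 := sub_ne_zero.2 h
  rw [regXi, dslope_of_ne _ h, slope_def_field, poleKernel]
  rw [sub_self, zero_pow two_ne_zero, sub_zero, div_one, sub_self, sub_zero, sub_div, div_div,
    mul_one_div, mul_comm (w - s)]

/-- The function inside `dslope` vanishes at `s`, so the quotient is removable there; the kernel's
other poles `s ± 1` bound the strip. -/
lemma differentiableOn_regXi (s : ℂ) :
    DifferentiableOn ℂ (regXi s) {w | |(w - s).re| < 1} := by
  have hopen : IsOpen {w : ℂ | |(w - s).re| < 1} :=
    isOpen_lt (by fun_prop) continuous_const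
  rw [regXi, Complex.differentiableOn_dslope (hopen.mem_nhds (by simp))]
  intro w hw
  have := one_sub_sq_ne_zero_of_abs_re_lt hw
  have h2 := differentiable_entireXi
  exact DifferentiableAt.differentiableWithinAt (by fun_prop (disch := exact this))

/-- `ξ` is symmetric and the kernel odd. At `w = 1 - s` the `dslope` is a derivative, hence the
separate case. -/
lemma regXi_one_sub (s w : ℂ) : regXi s (1 - w) = -regXi (1 - s) w := by
  rcases eq_or_ne w (1 - s) with rfl | h
  · have hF : (fun w => entireXi w - entireXi s / (1 - (w - s) ^ 2)) =
        fun w => (fun w => entireXi w - entireXi (1 - s) / (1 - (w - (1 - s)) ^ 2)) (1 - w) := by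
      ext w
      simp only [entireXi_one_sub]
      ring_nf
    rw [sub_sub_cancel, regXi, regXi, dslope_same, dslope_same, hF]
    exact deriv_comp_const_sub
      (fun w => entireXi w - entireXi (1 - s) / (1 - (w - (1 - s)) ^ 2)) 1 s
  · have h1 : 1 - w ≠ s := fun h' => h (by rw [← h']; ring)
    rw [regXi_eq h, regXi_eq h1, entireXi_one_sub, entireXi_one_sub,
      show 1 - w - s = -(w - (1 - s)) by ring, poleKernel_neg, div_neg]
    ring

lemma regXi_decay (s : ℂ) : ∃ C T : ℝ, ∀ w : ℂ, -1 ≤ w.re → w.re ≤ 2 → T ≤ |w.im| →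
    w.im ^ 2 * ‖regXi s w‖ ≤ C := by
  obtain ⟨C, hC0, hC⟩ := entireXi_decay
  -- For `|Im w| ≥ 2(1 + |Im s|)` one has `|Im w| ≤ 2 |Im (w - s)|`, whence the factor `4` on the
  -- kernel term.
  refine ⟨C + 4 * ‖entireXi s‖, 2 * (1 + |s.im|), fun w h1 h2 hT => ?_⟩
  have him : |w.im| / 2 ≤ |(w - s).im| := by
    have := abs_sub_abs_le_abs_sub w.im s.im
    rw [Complex.sub_im]
    linarith
  have him1 : 1 ≤ |(w - s).im| := by linarith [abs_nonneg s.im]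
  have hne : w ≠ s := by rintro rfl; norm_num at him1
  have hn : 1 ≤ ‖w - s‖ := him1.trans (Complex.abs_im_le_norm _)
  have hk := sq_mul_norm_poleKernel_le him1
  have hk2 : w.im ^ 2 * ‖poleKernel (w - s)‖ ≤ 4 := by
    have : w.im ^ 2 ≤ 4 * |(w - s).im| ^ 2 := by
      rw [← sq_abs w.im]
      nlinarith [abs_nonneg w.im]
    nlinarith [norm_nonneg (poleKernel (w - s))]
  have hx : w.im ^ 2 * ‖entireXi w / (w - s)‖ ≤ C := by
    rw [norm_div]
    refine le_trans ?_ (hC w h1 h2)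
    gcongr
    exact div_le_self (norm_nonneg _) hn
  rw [regXi_eq hne]
  calc w.im ^ 2 * ‖entireXi w / (w - s) - entireXi s * poleKernel (w - s)‖
      ≤ w.im ^ 2 * (‖entireXi w / (w - s)‖ + ‖entireXi s‖ * ‖poleKernel (w - s)‖) := by
        gcongr
        exact (norm_sub_le _ _).trans_eq (by rw [norm_mul])
    _ = w.im ^ 2 * ‖entireXi w / (w - s)‖ +
        ‖entireXi s‖ * (w.im ^ 2 * ‖poleKernel (w - s)‖) := by ring
    _ ≤ C + ‖entireXi s‖ * 4 := by gcongr
    _ = _ := by ring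

lemma integral_regXi_eq {s : ℂ} {a b : ℝ} (hab : a ≤ b) (ha : -1 ≤ a) (hb : b ≤ 2)
    (ha' : s.re - 1 < a) (hb' : b < s.re + 1) :
    Integrable (fun y : ℝ => regXi s (a + y * Complex.I)) ∧
    Integrable (fun y : ℝ => regXi s (b + y * Complex.I)) ∧
    ∫ y : ℝ, regXi s (a + y * Complex.I) = ∫ y : ℝ, regXi s (b + y * Complex.I) := by
  obtain ⟨C, T, hC⟩ := regXi_decay s
  refine integral_vertical_eq hab ((differentiableOn_regXi s).mono fun w hw => ?_)
    fun w h1 h2 h3 => hC w (ha.trans h1) (h2.trans hb) h3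
  simp only [Set.mem_ofPred_eq, Complex.sub_re, abs_lt]
  constructor <;> linarith [hw.1, hw.2]

/-- The symmetrized regularization integrates to zero, by the functional equation. -/
lemma integral_regXi_add_regXi_one_sub {s : ℂ} (h0 : 0 < s.re) (h1 : s.re < 1) :
    Integrable (fun y : ℝ => regXi s (1 + y * Complex.I)) ∧
    Integrable (fun y : ℝ => regXi (1 - s) (1 + y * Complex.I)) ∧
    (∫ y : ℝ, regXi s (1 + y * Complex.I)) + ∫ y : ℝ, regXi (1 - s) (1 + y * Complex.I) = 0 := by
  obtain ⟨-, i1, e1⟩ := integral_regXi_eq (s := s) (a := 1 / 2) (b := 1) (by norm_num)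
    (by norm_num) (by norm_num) (by linarith) (by linarith)
  obtain ⟨-, i2, e2⟩ := integral_regXi_eq (s := 1 - s) (a := 1 / 2) (b := 1) (by norm_num)
    (by norm_num) (by norm_num) (by simp; linarith) (by simp; linarith)
  rw [Complex.ofReal_one] at i1 e1 i2 e2
  refine ⟨i1, i2, ?_⟩
  -- On `Re w = 1/2` the reflection `y ↦ -y` is `w ↦ 1 - w`.
  rw [← e1, ← e2, ← integral_neg_eq_self, add_eq_zero_iff_eq_neg, ← integral_neg]
  congr 1 with y
  rw [← regXi_one_sub]
  congr 1
  push_cast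
  ring

/-- Shifting the line `Re w = 1` to `Re w = 3/2`. -/
lemma integral_regXi_one :
    Integrable (fun y : ℝ => regXi 1 (1 + y * Complex.I)) ∧
    ∫ y : ℝ, regXi 1 (1 + y * Complex.I) =
      (∫ y : ℝ, entireXi (3 / 2 + y * Complex.I) / (1 / 2 + y * Complex.I)) - Real.pi / 2 := by
  obtain ⟨i1, i2, e⟩ := integral_regXi_eq (s := 1) (a := 1) (b := 3 / 2) (by norm_num)
    (by norm_num) (by norm_num) (by simp) (by simp; norm_num)
  -- The subtracted kernel contributes `ξ(1) π = π/2`, half of the full residue term.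
  obtain ⟨k1, k2⟩ := integral_poleKernel (a := 1 / 2) (by norm_num) (by norm_num)
  rw [Complex.ofReal_one] at i1 e
  have hreg : ∀ y : ℝ, regXi 1 (((3 / 2 : ℝ) : ℂ) + y * Complex.I) =
      entireXi (3 / 2 + y * Complex.I) / (1 / 2 + y * Complex.I) -
        1 / 2 * poleKernel (((1 / 2 : ℝ) : ℂ) + y * Complex.I) := by
    intro y
    rw [regXi_eq (fun h => by have := congrArg Complex.re h; norm_num at this), entireXi_one]
    push_cast
    ring_nf
  refine ⟨i1, ?_⟩
  rw [e]
  have hX : Integrable fun y : ℝ => entireXi (3 / 2 + y * Complex.I) / (1 / 2 + y * Complex.I) := by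
    refine (i2.add (k1.const_mul (1 / 2))).congr (ae_of_all _ fun y => ?_)
    simp only [Pi.add_apply, hreg]
    ring
  simp_rw [hreg]
  rw [integral_sub hX (k1.const_mul _), integral_const_mul, k2]
  ring

/-! ### `θ₃` and its functional equation -/

noncomputable section

/-- The theta constant `θ₃` on the imaginary axis: `∑ exp(-π n² y)` over the integers. -/
def thetaThree (y : ℝ) : ℝ := ∑' n : ℤ, Real.exp (-Real.pi * y * n ^ 2)

end

lemma summable_sq_mul_exp {y : ℝ} (hy : 0 < y) :
    Summable fun n : ℤ => (n : ℝ) ^ 2 * Real.exp (-Real.pi * y * n ^ 2) := by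
  refine (HurwitzKernelBounds.summable_f_int 2 0 hy).congr fun n => ?_
  simp only [HurwitzKernelBounds.f_int, add_zero, sq_abs]
  ring_nf

lemma summable_exp_neg_sq {y : ℝ} (hy : 0 < y) :
    Summable fun n : ℤ => Real.exp (-Real.pi * y * n ^ 2) := by
  refine (HurwitzKernelBounds.summable_f_int 0 0 hy).congr fun n => ?_
  simp only [HurwitzKernelBounds.f_int, add_zero, pow_zero, one_mul]
  ring_nf

lemma thetaThree_eq {y : ℝ} (hy : 0 < y) :
    thetaThree y = 1 / y ^ (1 / 2 : ℝ) * thetaThree (1 / y) := by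
  rw [thetaThree, thetaThree, Real.tsum_exp_neg_mul_int_sq hy]
  simp only [mul_one_div]

/-- Termwise differentiation on `y > 1/2`, dominated by the differentiated series at `y = 1/2`. -/
lemma hasDerivAt_thetaThree :
    HasDerivAt thetaThree
      (-Real.pi * ∑' n : ℤ, (n : ℝ) ^ 2 * Real.exp (-Real.pi * 1 * n ^ 2)) 1 := by
  rw [← tsum_mul_left]
  refine hasDerivAt_tsum_of_isPreconnected (t := Set.Ioi (1 / 2))
    (g := fun (n : ℤ) (y : ℝ) => Real.exp (-Real.pi * y * n ^ 2))
    (g' := fun (n : ℤ) (y : ℝ) => -Real.pi * ((n : ℝ) ^ 2 * Real.exp (-Real.pi * y * n ^ 2)))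
    (u := fun n : ℤ => Real.pi * ((n : ℝ) ^ 2 * Real.exp (-Real.pi * (1 / 2) * n ^ 2)))
    ((summable_sq_mul_exp (y := 1 / 2) (by norm_num)).mul_left _) isOpen_Ioi isPreconnected_Ioi
    (fun n y hy => ?_) (fun n y hy => ?_) (y₀ := 1) (by simp; norm_num) (summable_exp_neg_sq one_pos)
    (by simp; norm_num)
  · have h := (((hasDerivAt_id y).const_mul (-Real.pi)).mul_const ((n : ℝ) ^ 2)).exp
    exact h.congr_deriv (by simp only [id]; ring)
  · have hy : 1 / 2 < y := hy
    rw [norm_mul, norm_neg, Real.norm_eq_abs, abs_of_pos Real.pi_pos, Real.norm_eq_abs,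
      abs_of_nonneg (by positivity)]
    have := Real.pi_pos
    gcongr ?_ * (?_ * Real.exp ?_)
    nlinarith [mul_nonneg (mul_nonneg this.le (sub_pos.2 hy).le) (sq_nonneg (n : ℝ))]

/-- The theta functional equation, differentiated at its fixed point. -/
lemma tsum_sq_mul_exp_int :
    Real.pi * ∑' n : ℤ, (n : ℝ) ^ 2 * Real.exp (-Real.pi * 1 * n ^ 2) = thetaThree 1 / 4 := by
  have hD := hasDerivAt_thetaThree
  set D := -Real.pi * ∑' n : ℤ, (n : ℝ) ^ 2 * Real.exp (-Real.pi * 1 * n ^ 2) with hDdef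
  -- Differentiating `θ₃(y) = y^(-1/2) θ₃(1/y)` at `1` gives `D = -θ₃(1)/2 - D`.
  have h1 : HasDerivAt (fun y : ℝ => y ^ (-(1 / 2) : ℝ) * thetaThree y⁻¹)
      (-(1 / 2) * thetaThree 1 - D) 1 := by
    have a1 : HasDerivAt (fun y : ℝ => y ^ (-(1 / 2) : ℝ)) (-(1 / 2)) 1 := by
      simpa using Real.hasDerivAt_rpow_const (x := 1) (p := -(1 / 2)) (Or.inl one_ne_zero)
    have a2 : HasDerivAt (fun y : ℝ => y⁻¹) (-1) 1 := by
      simpa using hasDerivAt_inv (one_ne_zero (α := ℝ))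
    have a3 : HasDerivAt (fun y : ℝ => thetaThree y⁻¹) (D * -1) 1 :=
      HasDerivAt.comp (h₂ := thetaThree) 1 (by simpa using hD) a2
    refine (a1.mul a3).congr_deriv ?_
    simp only [inv_one, Real.one_rpow]
    ring
  have h2 : thetaThree =ᶠ[𝓝 1] fun y : ℝ => y ^ (-(1 / 2) : ℝ) * thetaThree y⁻¹ := by
    filter_upwards [eventually_gt_nhds one_pos] with y hy
    rw [thetaThree_eq hy, one_div, one_div y, Real.rpow_neg hy.le]
  have := hD.unique (h1.congr_of_eventuallyEq h2)
  linarith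

lemma hasSum_nat_sq_mul_exp :
    HasSum (fun n : ℕ => ((n : ℝ) + 1) ^ 2 * Real.exp (-(Real.pi * ((n : ℝ) + 1) ^ 2)))
      (thetaThree 1 / (8 * Real.pi)) := by
  have hs := summable_sq_mul_exp one_pos
  have hnat : Summable fun n : ℕ =>
      ((n : ℝ) + 1) ^ 2 * Real.exp (-(Real.pi * ((n : ℝ) + 1) ^ 2)) := by
    refine (hs.comp_injective (i := fun n : ℕ => ((n : ℤ) + 1)) fun a b h => by simpa using h).congr
      fun n => ?_
    simp
  obtain ⟨S, hS⟩ := hnat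
  have h2 : HasSum (fun n : ℤ => (n : ℝ) ^ 2 * Real.exp (-Real.pi * 1 * n ^ 2)) (S + S) := by
    refine HasSum.of_nat_of_neg_add_one ?_ ?_
    · rw [← hasSum_nat_add_iff' 1]
      simpa using hS
    · convert hS using 2 with n
      push_cast
      ring_nf
  have h3 := tsum_sq_mul_exp_int
  rw [h2.tsum_eq] at h3
  have : S = thetaThree 1 / (8 * Real.pi) := by
    have := Real.pi_ne_zero
    field_simp
    linarith
  rwa [← this]

/-! ### The integral on `Re w = 3/2` by Cahen–Mellin inversion -/

lemma integrable_Gamma_vertical {σ : ℝ} (hσ : 0 < σ) :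
    Integrable fun y : ℝ => Complex.Gamma (σ + y * Complex.I) := by
  refine integrable_of_sq_mul_norm_le (C := Real.Gamma (σ + 2)) (T := 0) ?_ fun y _ => ?_
  · refine continuous_iff_continuousAt.2 fun y => ?_
    have := (Complex.differentiableAt_Gamma (σ + y * Complex.I) fun m h => by
      have := congrArg Complex.re h
      simp at this
      have h2 : (0 : ℝ) ≤ m := m.cast_nonneg
      linarith).continuousAt
    exact ContinuousAt.comp (f := fun y : ℝ => (σ + y * Complex.I : ℂ)) this (by fun_prop)
  · have h1 := norm_pow_mul_norm_Gamma_le (s := σ + y * Complex.I) (by simpa using hσ) 2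
    have h2 : |y| ≤ ‖(σ + y * Complex.I : ℂ)‖ := by
      simpa using Complex.abs_im_le_norm (σ + y * Complex.I)
    rw [← sq_abs]
    calc _ ≤ ‖(σ + y * Complex.I : ℂ)‖ ^ 2 * ‖Complex.Gamma (σ + y * Complex.I)‖ := by gcongr
      _ ≤ _ := by simpa using h1

/-- The Cahen–Mellin integral. -/
lemma integral_cpow_mul_Gamma {σ x : ℝ} (hσ : 0 < σ) (hx : 0 < x) :
    ∫ y : ℝ, (x : ℂ) ^ (-(σ + y * Complex.I)) * Complex.Gamma (σ + y * Complex.I) =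
      2 * Real.pi * Real.exp (-x) := by
  have hmel : ∀ y : ℝ, mellin (fun t : ℝ => ((Real.exp (-t) : ℝ) : ℂ)) (σ + y * Complex.I) =
      Complex.Gamma (σ + y * Complex.I) := by
    intro y
    rw [Complex.Gamma_eq_integral (by simpa using hσ), Complex.GammaIntegral_eq_mellin]
  have h := mellinInv_mellin_eq σ (fun t : ℝ => ((Real.exp (-t) : ℝ) : ℂ)) hx
    ((Complex.GammaIntegral_convergent (s := σ) (by simpa using hσ)).congr_fun
      (fun t _ => by simp [mul_comm]) measurableSet_Ioi)
    (by simpa only [Complex.VerticalIntegrable, hmel] using integrable_Gamma_vertical hσ)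
    (by fun_prop)
  simp only [mellinInv, hmel, smul_eq_mul] at h
  rw [← h, Complex.real_smul]
  push_cast
  have : (Real.pi : ℂ) ≠ 0 := by exact_mod_cast Real.pi_ne_zero
  rw [← mul_assoc, mul_one_div_cancel (mul_ne_zero two_ne_zero this), one_mul]

/-- The factor `w - 1` of `ξ` cancels, and `π^(-w/2) n^(-w) = (π n²)^(-w/2)`. -/
lemma hasSum_entireXi_div {w : ℂ} (hw : 1 < w.re) :
    HasSum (fun n : ℕ => ((Real.pi * ((n : ℝ) + 1) ^ 2 : ℝ) : ℂ) ^ (-(w / 2)) *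
      Complex.Gamma (1 + w / 2)) (entireXi w / (w - 1)) := by
  have h1 : w ≠ 1 := by rintro rfl; simp at hw
  have h2 : w - 1 ≠ 0 := sub_ne_zero.2 h1
  have hz : HasSum (fun n : ℕ => 1 / ((n : ℂ) + 1) ^ w) (riemannZeta w) := by
    rw [zeta_eq_tsum_one_div_nat_add_one_cpow hw]
    refine Summable.hasSum ?_
    have := (summable_nat_add_iff 1).2 (Complex.summable_one_div_nat_cpow.2 hw)
    simpa using this
  have hX : entireXi w / (w - 1) =
      (Real.pi : ℂ) ^ (-w / 2) * riemannZeta w * Complex.Gamma (1 + w / 2) := by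
    rw [← riemannXi_eq_entireXi (by linarith) h1, riemannXi]
    field_simp
  rw [hX]
  have hterm : (fun n : ℕ => ((Real.pi * ((n : ℝ) + 1) ^ 2 : ℝ) : ℂ) ^ (-(w / 2)) *
      Complex.Gamma (1 + w / 2)) = fun n : ℕ =>
      (Real.pi : ℂ) ^ (-w / 2) * (1 / ((n : ℂ) + 1) ^ w) * Complex.Gamma (1 + w / 2) := by
    ext n
    have hn : (0 : ℝ) ≤ (n : ℝ) + 1 := by positivity
    have hn0 : (((n : ℝ) + 1 : ℝ) : ℂ) ≠ 0 := by
      exact_mod_cast (by positivity : (n : ℝ) + 1 ≠ 0)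
    rw [Complex.ofReal_mul, Complex.mul_cpow_ofReal_nonneg Real.pi_pos.le (by positivity), sq,
      Complex.ofReal_mul, Complex.mul_cpow_ofReal_nonneg hn hn, ← Complex.cpow_add _ _ hn0,
      neg_div, ← neg_add, add_halves, Complex.cpow_neg _ w]
    push_cast
    ring
  rw [hterm]
  exact (hz.mul_left _).mul_right _

/-- With `w = 3/2 + 2iy` and `x = π n²`, the `n`-th term is `x · x^(-z) Γ(z)` for `z = 7/4 + iy`,
which integrates to `2π x exp(-x)`. The sum is `π θ₃(1)/4`, and undoing `y ↦ 2y` doubles it. -/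
lemma integral_entireXi_div :
    ∫ y : ℝ, entireXi (3 / 2 + y * Complex.I) / (1 / 2 + y * Complex.I) =
      Real.pi * thetaThree 1 / 2 := by
  set x : ℕ → ℝ := fun n => Real.pi * ((n : ℝ) + 1) ^ 2 with hx
  have hx0 : ∀ n, 0 < x n := fun n => by have := Real.pi_pos; positivity
  set G : ℝ → ℂ := fun y => Complex.Gamma ((7 / 4 : ℝ) + y * Complex.I) with hG
  have hGi : Integrable G := integrable_Gamma_vertical (by norm_num)
  set F : ℕ → ℝ → ℂ := fun n y =>
    x n * ((x n : ℂ) ^ (-((7 / 4 : ℝ) + y * Complex.I)) * G y) with hF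
  have hpt : ∀ y : ℝ, ∑' n, F n y =
      entireXi (3 / 2 + (2 * y : ℝ) * Complex.I) / (1 / 2 + (2 * y : ℝ) * Complex.I) := by
    intro y
    have := hasSum_entireXi_div (w := 3 / 2 + (2 * y : ℝ) * Complex.I) (by
      simp only [Complex.add_re, Complex.re_ofReal_mul, Complex.I_re]; norm_num)
    rw [show (3 / 2 + (2 * y : ℝ) * Complex.I : ℂ) - 1 = 1 / 2 + (2 * y : ℝ) * Complex.I by ring]
      at this
    rw [← this.tsum_eq]
    congr 1 with n
    have hxn : (x n : ℂ) ≠ 0 := by exact_mod_cast (hx0 n).ne'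
    have e1 : -((3 / 2 + (2 * y : ℝ) * Complex.I : ℂ) / 2) =
      1 + -((7 / 4 : ℝ) + y * Complex.I) := by push_cast; ring
    have e2 : (1 + (3 / 2 + (2 * y : ℝ) * Complex.I) / 2 : ℂ) =
      (7 / 4 : ℝ) + y * Complex.I := by push_cast; ring
    rw [e1, e2, Complex.cpow_add _ _ hxn, Complex.cpow_one, mul_assoc]
  have hnorm : ∀ n y, ‖F n y‖ = x n ^ (-(3 / 4) : ℝ) * ‖G y‖ := by
    intro n y
    simp only [hF, norm_mul]
    rw [Complex.norm_cpow_eq_rpow_re_of_pos (hx0 n), ← mul_assoc, Complex.norm_real,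
      Real.norm_eq_abs, abs_of_pos (hx0 n), ← Real.rpow_one_add' (hx0 n).le]
    · congr 2
      simp
      norm_num
    · simp
      norm_num
  have hcont : ∀ n, Continuous fun y : ℝ => (x n : ℂ) ^ (-((7 / 4 : ℝ) + y * Complex.I)) := by
    intro n
    have hxn : (x n : ℂ) ≠ 0 := by exact_mod_cast (hx0 n).ne'
    exact Continuous.const_cpow (by fun_prop) (Or.inl hxn)
  have hFi : ∀ n, Integrable (F n) := by
    intro n
    refine (hGi.norm.const_mul (x n ^ (-(3 / 4) : ℝ))).mono' ?_ (ae_of_all _ fun y => (hnorm n y).le)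
    exact (((hcont n).aestronglyMeasurable).mul hGi.aestronglyMeasurable).const_mul _
  -- The `n`-th norm is a multiple of `x^(1 - 7/4) = x^(-3/4)`, of size `n^(-3/2)`; this is why the
  -- line `3/2`, right of `1`, is used.
  have hsum : Summable fun n => ∫ y, ‖F n y‖ := by
    simp_rw [hnorm, integral_const_mul]
    refine Summable.mul_right _ ?_
    have h1 : Summable fun n : ℕ => Real.pi ^ (-(3 / 4) : ℝ) * (1 / ((n : ℝ) + 1) ^ (3 / 2 : ℝ)) := by
      refine Summable.mul_left _ ?_
      have := (summable_nat_add_iff 1).2 (Real.summable_one_div_nat_rpow.2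
        (by norm_num : (1 : ℝ) < 3 / 2))
      simpa using this
    refine h1.congr fun n => ?_
    have hn : (0 : ℝ) ≤ (n : ℝ) + 1 := by positivity
    rw [hx, Real.mul_rpow Real.pi_pos.le (by positivity), ← Real.rpow_natCast_mul hn,
      one_div, ← Real.rpow_neg hn]
    norm_num
  have h := hasSum_integral_of_summable_integral_norm hFi hsum
  have hval : ∀ n, ∫ y, F n y = ((4 * Real.pi ^ 2 / 2 * (((n : ℝ) + 1) ^ 2 *
      Real.exp (-(Real.pi * ((n : ℝ) + 1) ^ 2))) : ℝ) : ℂ) := by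
    intro n
    simp only [hF, hG]
    rw [integral_const_mul, integral_cpow_mul_Gamma (by norm_num) (hx0 n)]
    simp only [hx]
    push_cast
    ring
  simp_rw [hval, hpt] at h
  have h3 := (hasSum_nat_sq_mul_exp.mul_left (4 * Real.pi ^ 2 / 2))
  have h4 := h.unique (Complex.hasSum_ofReal.2 h3)
  have h5 := Measure.integral_comp_mul_left
    (fun y : ℝ => entireXi (3 / 2 + y * Complex.I) / (1 / 2 + y * Complex.I)) 2
  rw [h4, Complex.real_smul] at h5
  have hpi : (Real.pi : ℂ) ≠ 0 := by exact_mod_cast Real.pi_ne_zero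
  rw [abs_of_pos (by norm_num)] at h5
  generalize (∫ y : ℝ, entireXi (3 / 2 + y * Complex.I) / (1 / 2 + y * Complex.I)) = Z at h5 ⊢
  push_cast at h5
  field_simp at h5
  linear_combination -h5 / 8

/-! ### Doubling formulas for `θ₃` and `θ₄` -/

noncomputable section

/-- The theta constant `θ₄` on the imaginary axis: `∑ (-1)^n exp(-π n² y)` over the integers. -/
def thetaFour (y : ℝ) : ℝ := ∑' n : ℤ, (-1 : ℝ) ^ n * Real.exp (-Real.pi * y * n ^ 2)

end

lemma abs_neg_one_zpow_mul (n : ℤ) (x : ℝ) : |(-1 : ℝ) ^ n * x| = |x| := by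
  rw [abs_mul, abs_neg_one_zpow, one_mul]

lemma summable_neg_one_zpow_mul_exp {y : ℝ} (hy : 0 < y) :
    Summable fun n : ℤ => (-1 : ℝ) ^ n * Real.exp (-Real.pi * y * n ^ 2) := by
  refine Summable.of_norm_bounded (summable_exp_neg_sq hy) fun n => ?_
  rw [Real.norm_eq_abs, abs_neg_one_zpow_mul, abs_of_pos (Real.exp_pos _)]

/-- A double sum supported on pairs of equal parity, rewritten along `(a + b, a - b)`. -/
lemma tsum_of_odd_eq_zero {f : ℤ × ℤ → ℝ} (hf : ∀ p : ℤ × ℤ, ¬ Even (p.1 + p.2) → f p = 0) :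
    ∑' p, f p = ∑' p : ℤ × ℤ, f (p.1 + p.2, p.1 - p.2) := by
  have hinj : Function.Injective fun p : ℤ × ℤ => (p.1 + p.2, p.1 - p.2) := by
    rintro ⟨a, b⟩ ⟨c, d⟩ h
    simp only [Prod.mk.injEq] at h ⊢
    omega
  refine (hinj.tsum_eq fun p hp => ?_).symm
  have : Even (p.1 + p.2) := by
    by_contra h
    exact hp (hf p h)
  obtain ⟨k, hk⟩ := this
  exact ⟨(k, p.1 - k), by ext <;> simp; omega⟩

lemma exp_add_mul_exp_sub (y : ℝ) (a b : ℤ) :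
    Real.exp (-Real.pi * y * ((a + b : ℤ) : ℝ) ^ 2) *
      Real.exp (-Real.pi * y * ((a - b : ℤ) : ℝ) ^ 2) =
    Real.exp (-Real.pi * (2 * y) * (a : ℝ) ^ 2) * Real.exp (-Real.pi * (2 * y) * (b : ℝ) ^ 2) := by
  rw [← Real.exp_add, ← Real.exp_add]
  push_cast
  ring_nf

/-- In the double sum the weight `1 + (-1)^(m+n)` keeps only pairs of equal parity. With `m = a +
b`, `n = a - b` one has `m² + n² = 2(a² + b²)`, which doubles `y`. -/
lemma thetaThree_sq_add_thetaFour_sq {y : ℝ} (hy : 0 < y) :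
    thetaThree y ^ 2 + thetaFour y ^ 2 = 2 * thetaThree (2 * y) ^ 2 := by
  have h3 := (summable_exp_neg_sq hy).norm
  have h4 := (summable_neg_one_zpow_mul_exp hy).norm
  have h32 := (summable_exp_neg_sq (y := 2 * y) (by positivity)).norm
  rw [sq, sq, sq, thetaThree, thetaFour, thetaThree, tsum_mul_tsum_of_summable_norm h3 h3,
    tsum_mul_tsum_of_summable_norm h4 h4, tsum_mul_tsum_of_summable_norm h32 h32,
    ← (summable_mul_of_summable_norm h3 h3).tsum_add (summable_mul_of_summable_norm h4 h4),
    tsum_of_odd_eq_zero, ← tsum_mul_left]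
  · congr 1 with p
    rw [← exp_add_mul_exp_sub]
    have : (-1 : ℝ) ^ (p.1 + p.2) * (-1 : ℝ) ^ (p.1 - p.2) = 1 := by
      rw [← zpow_add₀ (by norm_num)]
      exact Even.neg_one_zpow ⟨p.1, by ring⟩
    linear_combination (Real.exp (-Real.pi * y * ((p.1 + p.2 : ℤ) : ℝ) ^ 2) *
      Real.exp (-Real.pi * y * ((p.1 - p.2 : ℤ) : ℝ) ^ 2)) * this
  · intro p hp
    have : (-1 : ℝ) ^ p.1 * (-1 : ℝ) ^ p.2 = -1 := by
      rw [← zpow_add₀ (by norm_num)]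
      exact Odd.neg_one_zpow (Int.not_even_iff_odd.1 hp)
    linear_combination (Real.exp (-Real.pi * y * (p.1 : ℝ) ^ 2) *
      Real.exp (-Real.pi * y * (p.2 : ℝ) ^ 2)) * this

lemma thetaThree_mul_thetaFour {y : ℝ} (hy : 0 < y) :
    thetaThree y * thetaFour y = thetaFour (2 * y) ^ 2 := by
  have h3 := (summable_exp_neg_sq hy).norm
  have h4 := (summable_neg_one_zpow_mul_exp hy).norm
  have h42 := (summable_neg_one_zpow_mul_exp (y := 2 * y) (by positivity)).norm
  -- Adding the product to itself with factors swapped produces the weight `(-1)^m + (-1)^n`, which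
  -- vanishes at unequal parity.
  have hdouble : 2 * (thetaThree y * thetaFour y) = 2 * thetaFour (2 * y) ^ 2 := by
    nth_rewrite 1 [two_mul]
    nth_rewrite 2 [mul_comm]
    rw [sq, thetaThree, thetaFour, thetaFour, tsum_mul_tsum_of_summable_norm h3 h4,
      tsum_mul_tsum_of_summable_norm h4 h3, tsum_mul_tsum_of_summable_norm h42 h42,
      ← (summable_mul_of_summable_norm h3 h4).tsum_add (summable_mul_of_summable_norm h4 h3),
      tsum_of_odd_eq_zero, ← tsum_mul_left]
    · congr 1 with p
      have e := exp_add_mul_exp_sub y p.1 p.2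
      have e1 : (-1 : ℝ) ^ (p.1 + p.2) = (-1 : ℝ) ^ p.1 * (-1 : ℝ) ^ p.2 :=
        zpow_add₀ (by norm_num) _ _
      have e2 : (-1 : ℝ) ^ (p.1 - p.2) = (-1 : ℝ) ^ p.1 * (-1 : ℝ) ^ p.2 := by
        rw [sub_eq_add_neg, zpow_add₀ (by norm_num), zpow_neg, ← inv_zpow]
        norm_num
      simp only [e1, e2]
      linear_combination (2 * (-1 : ℝ) ^ p.1 * (-1 : ℝ) ^ p.2) * e
    · intro p hp
      have : (-1 : ℝ) ^ p.1 + (-1 : ℝ) ^ p.2 = 0 := by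
        rcases Int.even_or_odd p.1 with h1 | h1 <;> rcases Int.even_or_odd p.2 with h2 | h2
        · exact absurd (h1.add h2) hp
        · rw [h1.neg_one_zpow, h2.neg_one_zpow]; norm_num
        · rw [h1.neg_one_zpow, h2.neg_one_zpow]; norm_num
        · exact absurd (h1.add_odd h2) hp
      linear_combination (Real.exp (-Real.pi * y * (p.1 : ℝ) ^ 2) *
        Real.exp (-Real.pi * y * (p.2 : ℝ) ^ 2)) * this
  linarith

lemma thetaThree_pos {y : ℝ} (hy : 0 < y) : 0 < thetaThree y :=
  (summable_exp_neg_sq hy).tsum_pos (fun _ => (Real.exp_pos _).le) 0 (Real.exp_pos _)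

/-- At the fixed point `y = 1` of the functional equation, `θ₃⁴ = 2 θ₄⁴`. -/
lemma thetaThree_one_sq : thetaThree 1 ^ 2 = √2 * thetaFour 1 ^ 2 := by
  have f : thetaThree (1 / 2) ^ 2 = 2 * thetaThree 2 ^ 2 := by
    have := thetaThree_eq (y := 1 / 2) (by norm_num)
    rw [one_div_one_div, ← Real.sqrt_eq_rpow] at this
    rw [this, mul_pow, div_pow, Real.sq_sqrt (by norm_num)]
    norm_num
  have e1 := thetaThree_sq_add_thetaFour_sq (y := 1) one_pos
  have e2 := thetaThree_sq_add_thetaFour_sq (y := 1 / 2) (by norm_num)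
  have e3 := thetaThree_mul_thetaFour (y := 1 / 2) (by norm_num)
  norm_num at e1 e2 e3
  have h4 : thetaFour (1 / 2) ^ 2 = thetaThree 1 ^ 2 - thetaFour 1 ^ 2 := by linarith
  -- `θ₃(1/2)² = 2 θ₃(2)² = θ₃(1)² + θ₄(1)²`, so the product formula at `1/2` becomes `θ₄⁴ = θ₃⁴ -
  -- θ₄⁴` at `1`.
  have h5 : (thetaFour 1 ^ 2) ^ 2 = (thetaThree 1 ^ 2 + thetaFour 1 ^ 2) *
      (thetaThree 1 ^ 2 - thetaFour 1 ^ 2) := by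
    have e4 : (thetaFour 1 ^ 2) ^ 2 = thetaThree (1 / 2) ^ 2 * thetaFour (1 / 2) ^ 2 := by
      rw [← e3]; ring
    rw [e4, h4, f]
    linear_combination (-(thetaThree 1 ^ 2 - thetaFour 1 ^ 2)) * e1
  refine (sq_eq_sq₀ (by positivity) (by positivity)).1 ?_
  rw [mul_pow, Real.sq_sqrt (by norm_num)]
  linarith

/-- Only the `n = 0` term survives; the series at `k = 0` dominates. -/
lemma tendsto_tsum_mul_exp {c : ℤ → ℝ} (h0 : c 0 = 1) (hc : ∀ n, |c n| ≤ 1) :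
    Tendsto (fun k : ℕ => ∑' n : ℤ, c n * Real.exp (-Real.pi * 2 ^ k * n ^ 2)) atTop (𝓝 1) := by
  have := Real.pi_pos
  rw [← tsum_ite_eq (0 : ℤ) (fun _ => (1 : ℝ))]
  refine tendsto_tsum_of_dominated_convergence (summable_exp_neg_sq one_pos) (fun n => ?_)
    (Eventually.of_forall fun k n => ?_)
  · split_ifs with hn
    · simp [hn, h0]
    · have hn2 : (0 : ℝ) < Real.pi * n ^ 2 := by positivity
      have h1 : Tendsto (fun k : ℕ => Real.exp (-(Real.pi * n ^ 2 * 2 ^ k))) atTop (𝓝 0) :=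
        Real.tendsto_exp_neg_atTop_nhds_zero.comp
          ((tendsto_pow_atTop_atTop_of_one_lt (one_lt_two : (1 : ℝ) < 2)).const_mul_atTop hn2)
      have h2 := h1.const_mul (c n)
      rw [mul_zero] at h2
      refine h2.congr fun k => ?_
      ring_nf
  · rw [norm_mul, Real.norm_eq_abs, Real.norm_eq_abs, abs_of_pos (Real.exp_pos _)]
    calc |c n| * Real.exp (-Real.pi * 2 ^ k * n ^ 2)
        ≤ 1 * Real.exp (-Real.pi * 2 ^ k * n ^ 2) := by gcongr; exact hc n
      _ ≤ Real.exp (-Real.pi * 1 * n ^ 2) := by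
        rw [one_mul]
        apply Real.exp_le_exp.2
        have h2 : (1 : ℝ) ≤ 2 ^ k := one_le_pow₀ one_le_two
        nlinarith [mul_nonneg (mul_nonneg this.le (sub_nonneg.2 h2)) (sq_nonneg (n : ℝ))]

lemma tendsto_thetaThree : Tendsto (fun k : ℕ => thetaThree (2 ^ k)) atTop (𝓝 1) := by
  simpa [thetaThree] using tendsto_tsum_mul_exp (c := fun _ => 1) rfl (by simp)

lemma tendsto_thetaFour : Tendsto (fun k : ℕ => thetaFour (2 ^ k)) atTop (𝓝 1) :=
  tendsto_tsum_mul_exp (by simp) fun n => (abs_neg_one_zpow n).le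

/-! ### Gauss's integral and the arithmetic-geometric mean -/

noncomputable section

/-- Gauss's elliptic integral `∫ dx / √((x² + a²)(x² + b²))` over the real line. -/
def agmIntegral (a b : ℝ) : ℝ := ∫ x : ℝ, 1 / √((x ^ 2 + a ^ 2) * (x ^ 2 + b ^ 2))

end

lemma integral_even_eq {f : ℝ → ℝ} (hf : ∀ x, f |x| = f x) :
    ∫ x, f x = 2 * ∫ x in Set.Ioi (0 : ℝ), f x := by
  rw [← integral_comp_abs]
  simp_rw [hf]

/-- Gauss's transformation: the integral is invariant under the arithmetic-geometric step. -/
lemma agmIntegral_step {a b g : ℝ} (ha : 0 < a) (hb : 0 < b) (hg : g ^ 2 = a * b) :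
    agmIntegral ((a + b) / 2) g = agmIntegral a b := by
  have hab : 0 < a * b := by positivity
  -- This substitution maps `(0, ∞)` bijectively onto `ℝ`; the preimage of `u` is the positive root
  -- of `x² - 2ux - ab = 0`.
  set φ : ℝ → ℝ := fun x => (x - a * b / x) / 2 with hφ
  set φ' : ℝ → ℝ := fun x => (x ^ 2 + a * b) / (2 * x ^ 2) with hφ'
  have hder : ∀ x ∈ Set.Ioi (0 : ℝ), HasDerivWithinAt φ (φ' x) (Set.Ioi 0) x := by
    intro x hx
    have hx : 0 < x := hx
    have h1 : HasDerivAt φ ((1 - a * b * (-(x ^ 2)⁻¹)) / 2) x := by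
      simp only [hφ, div_eq_mul_inv (a * b)]
      exact ((hasDerivAt_id' x).fun_sub ((hasDerivAt_inv hx.ne').const_mul (a * b))).div_const 2
    refine (h1.congr_deriv ?_).hasDerivWithinAt
    simp only [hφ']
    field_simp
    ring
  have hinj : Set.InjOn φ (Set.Ioi 0) := by
    intro x hx y hy h
    have hx : 0 < x := hx
    have hy : 0 < y := hy
    simp only [hφ] at h
    field_simp at h
    have h2 : (x - y) * (x * y + a * b) = 0 := by linear_combination h
    rcases mul_eq_zero.1 h2 with h3 | h3
    · linarith
    · have : 0 < x * y := by positivity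
      linarith
  have himg : φ '' Set.Ioi 0 = Set.univ := by
    refine Set.eq_univ_of_forall fun u => ?_
    have h1 : |u| < √(u ^ 2 + a * b) := Real.lt_sqrt_of_sq_lt (by rw [sq_abs]; linarith)
    have h2 := Real.sq_sqrt (show 0 ≤ u ^ 2 + a * b by positivity)
    have h3 : 0 < u + √(u ^ 2 + a * b) := by linarith [neg_abs_le u]
    refine ⟨u + √(u ^ 2 + a * b), h3, ?_⟩
    simp only [hφ]
    field_simp
    linear_combination h2
  have hsub := integral_image_eq_integral_abs_deriv_smul measurableSet_Ioi hder hinj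
    (fun u => 1 / √((u ^ 2 + ((a + b) / 2) ^ 2) * (u ^ 2 + g ^ 2)))
  rw [himg, Measure.restrict_univ] at hsub
  rw [agmIntegral, hsub, agmIntegral, integral_even_eq (by simp), ← integral_const_mul]
  refine setIntegral_congr_fun measurableSet_Ioi fun x hx => ?_
  have hx : 0 < x := hx
  -- The new quartic is the old one times a square, which cancels against `φ'` up to the factor `2`
  -- from evenness.
  have e : (φ x ^ 2 + ((a + b) / 2) ^ 2) * (φ x ^ 2 + g ^ 2) =
      ((x ^ 2 + a * b) / (4 * x ^ 2)) ^ 2 * ((x ^ 2 + a ^ 2) * (x ^ 2 + b ^ 2)) := by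
    rw [hg]
    simp only [hφ]
    field_simp
    ring
  have hs : 0 < √((x ^ 2 + a ^ 2) * (x ^ 2 + b ^ 2)) := Real.sqrt_pos.2 (by positivity)
  simp only [smul_eq_mul]
  rw [e, Real.sqrt_mul (sq_nonneg _), Real.sqrt_sq (by positivity), abs_of_pos (by positivity)]
  simp only [hφ']
  field_simp
  norm_num

lemma integral_one_div_sq_add_sq {c : ℝ} (hc : 0 < c) :
    Integrable (fun x : ℝ => 1 / (x ^ 2 + c ^ 2)) ∧
      ∫ x : ℝ, 1 / (x ^ 2 + c ^ 2) = Real.pi / c := by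
  obtain ⟨h1, h2⟩ := integral_univ_div_sq_add_sq hc
  have e : (fun x : ℝ => 1 / (x ^ 2 + c ^ 2)) = fun x => c⁻¹ * (c / (c ^ 2 + x ^ 2)) := by
    ext x; field_simp; ring
  rw [e]
  exact ⟨h1.const_mul _, by rw [integral_const_mul, h2]; field_simp⟩

lemma agmIntegral_mem_Icc {a b m M : ℝ} (hm : 0 < m) (ha : m ≤ a) (hb : m ≤ b) (ha' : a ≤ M)
    (hb' : b ≤ M) : agmIntegral a b ∈ Set.Icc (Real.pi / M) (Real.pi / m) := by
  have hM : 0 < M := by linarith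
  obtain ⟨i1, v1⟩ := integral_one_div_sq_add_sq hm
  obtain ⟨i2, v2⟩ := integral_one_div_sq_add_sq hM
  have hlow : ∀ x : ℝ, 1 / (x ^ 2 + M ^ 2) ≤ 1 / √((x ^ 2 + a ^ 2) * (x ^ 2 + b ^ 2)) := by
    intro x
    have : 0 < (x ^ 2 + a ^ 2) * (x ^ 2 + b ^ 2) := by
      have : 0 < a := by linarith
      have : 0 < b := by linarith
      positivity
    refine one_div_le_one_div_of_le (Real.sqrt_pos.2 this) ?_
    refine Real.sqrt_le_iff.2 ⟨by positivity, ?_⟩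
    rw [sq (x ^ 2 + M ^ 2)]
    gcongr <;> linarith
  have hup : ∀ x : ℝ, 1 / √((x ^ 2 + a ^ 2) * (x ^ 2 + b ^ 2)) ≤ 1 / (x ^ 2 + m ^ 2) := by
    intro x
    refine one_div_le_one_div_of_le (by positivity) ?_
    refine Real.le_sqrt_of_sq_le ?_
    rw [sq (x ^ 2 + m ^ 2)]
    gcongr
  have hi : Integrable fun x : ℝ => 1 / √((x ^ 2 + a ^ 2) * (x ^ 2 + b ^ 2)) := by
    refine i1.mono' (Measurable.aestronglyMeasurable (by fun_prop)) (ae_of_all _ fun x => ?_)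
    rw [Real.norm_eq_abs, abs_of_nonneg (by positivity)]
    exact hup x
  exact ⟨v2 ▸ integral_mono i2 hi hlow, v1 ▸ integral_mono hi i1 hup⟩

/-- Positivity is not evident from the alternating series; nonvanishing propagates by doubling from
`y = 1` and keeps the arithmetic-geometric step applicable. -/
lemma thetaFour_two_pow_ne_zero (k : ℕ) : thetaFour (2 ^ k) ≠ 0 := by
  induction k with
  | zero =>
    intro h
    have := thetaThree_one_sq
    rw [pow_zero] at h
    rw [h] at this
    have := thetaThree_pos one_pos
    nlinarith
  | succ k ih =>
    intro h
    have := thetaThree_mul_thetaFour (y := 2 ^ k) (by positivity)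
    rw [← pow_succ', h] at this
    have h3 := thetaThree_pos (y := 2 ^ k) (by positivity)
    simp [h3.ne', ih] at this

/-- The doubling formulas say that `θ₃(2y)²` and `θ₄(2y)²` are the arithmetic and geometric means of
`θ₃(y)²` and `θ₄(y)²`. -/
lemma agmIntegral_theta (k : ℕ) :
    agmIntegral (thetaThree (2 ^ k) ^ 2) (thetaFour (2 ^ k) ^ 2) =
      agmIntegral (thetaThree 1 ^ 2) (thetaFour 1 ^ 2) := by
  induction k with
  | zero => rw [pow_zero]
  | succ k ih =>
    have hpos : (0 : ℝ) < 2 ^ k := by positivity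
    have h3 := thetaThree_pos hpos
    have h4 := thetaFour_two_pow_ne_zero k
    have e1 := thetaThree_sq_add_thetaFour_sq hpos
    have e2 := thetaThree_mul_thetaFour hpos
    have h := agmIntegral_step (a := thetaThree (2 ^ k) ^ 2) (b := thetaFour (2 ^ k) ^ 2)
      (g := thetaFour (2 * 2 ^ k) ^ 2) (by positivity) (by positivity) (by rw [← e2]; ring)
    rw [e1, mul_div_cancel_left₀ _ two_ne_zero] at h
    rw [← ih, ← h, pow_succ' (2 : ℝ) k]

/-- The value is constant along `y = 2^k` and lies between `π/max` and `π/min` of two sequences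
tending to `1`. -/
lemma agmIntegral_theta_one : agmIntegral (thetaThree 1 ^ 2) (thetaFour 1 ^ 2) = Real.pi := by
  have t3 := tendsto_thetaThree.pow 2
  have t4 := tendsto_thetaFour.pow 2
  rw [one_pow] at t3 t4
  have hpos : ∀ k : ℕ, 0 < min (thetaThree (2 ^ k) ^ 2) (thetaFour (2 ^ k) ^ 2) := fun k => by
    have h3 := thetaThree_pos (y := 2 ^ k) (by positivity)
    have h4 := thetaFour_two_pow_ne_zero k
    exact lt_min (by positivity) (by positivity)
  have hmem := fun k => agmIntegral_theta k ▸ agmIntegral_mem_Icc (hpos k) (min_le_left _ _)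
    (min_le_right _ _) (le_max_left _ _) (le_max_right _ _)
  have l1 := tendsto_const_nhds (x := Real.pi).div (t3.max t4) (by simp)
  have l2 := tendsto_const_nhds (x := Real.pi).div (t3.min t4) (by simp)
  simp only [max_self, min_self, div_one] at l1 l2
  exact le_antisymm (ge_of_tendsto' l2 fun k => (hmem k).2) (le_of_tendsto' l1 fun k => (hmem k).1)

/-! ### The lemniscate integral and the value of `θ₃(1)` -/

lemma integral_Ioo_beta {u v : ℝ} (hu : 0 < u) (hv : 0 < v) :
    ∫ x in Set.Ioo (0 : ℝ) 1, x ^ (u - 1) * (1 - x) ^ (v - 1) =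
      Real.Gamma u * Real.Gamma v / Real.Gamma (u + v) := by
  have h := ProbabilityTheory.beta_eq_betaIntegralReal u v hu hv
  rw [ProbabilityTheory.beta] at h
  rw [h, Complex.betaIntegral, intervalIntegral.integral_of_le zero_le_one,
    integral_Ioc_eq_integral_Ioo]
  have : ∫ x in Set.Ioo (0 : ℝ) 1, (x : ℂ) ^ ((u : ℂ) - 1) * (1 - (x : ℂ)) ^ ((v : ℂ) - 1) =
      ∫ x in Set.Ioo (0 : ℝ) 1, ((x ^ (u - 1) * (1 - x) ^ (v - 1) : ℝ) : ℂ) := by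
    refine setIntegral_congr_fun measurableSet_Ioo fun x hx => ?_
    rw [Complex.ofReal_mul, Complex.ofReal_cpow hx.1.le, Complex.ofReal_cpow (by linarith [hx.2])]
    push_cast
    rfl
  rw [this, integral_complex_ofReal, Complex.ofReal_re]

/-- The lemniscate integral. -/
lemma agmIntegral_sqrt_two_one :
    agmIntegral (√2) 1 = Real.Gamma (1 / 4) * Real.Gamma (1 / 2) / Real.Gamma (3 / 4) / 2 := by
  -- The substitution `y = (1 + t²)^(-2)` turns the beta integral `B(1/4, 1/2)` into four times the
  -- half-line integral.
  set φ : ℝ → ℝ := fun t => ((1 + t ^ 2) ^ 2)⁻¹ with hφ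
  set φ' : ℝ → ℝ := fun t => -(4 * t * (1 + t ^ 2)) / ((1 + t ^ 2) ^ 2) ^ 2 with hφ'
  have hder : ∀ x ∈ Set.Ioi (0 : ℝ), HasDerivWithinAt φ (φ' x) (Set.Ioi 0) x := by
    intro x hx
    have h1 : HasDerivAt (fun t : ℝ => (1 + t ^ 2) ^ 2) (4 * x * (1 + x ^ 2)) x := by
      refine (((hasDerivAt_pow 2 x).const_add 1).pow 2).congr_deriv ?_
      push_cast
      ring
    exact (h1.inv (by positivity)).hasDerivWithinAt
  have hinj : Set.InjOn φ (Set.Ioi 0) := by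
    intro x hx y hy h
    have hx : 0 < x := hx
    have hy : 0 < y := hy
    have h1 := inv_injective h
    have h2 := (sq_eq_sq₀ (by positivity) (by positivity)).1 h1
    exact (sq_eq_sq₀ hx.le hy.le).1 (by linarith)
  have himg : φ '' Set.Ioi 0 = Set.Ioo 0 1 := by
    ext y
    constructor
    · rintro ⟨t, ht, rfl⟩
      have ht : 0 < t := ht
      exact ⟨by positivity, inv_lt_one_of_one_lt₀ (one_lt_pow₀ (by nlinarith) two_ne_zero)⟩
    · rintro ⟨h0, h1⟩
      have hy : 0 < √y := Real.sqrt_pos.2 h0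
      have hy1 : √y < 1 := by rw [Real.sqrt_lt' one_pos]; simpa using h1
      have h2 : 0 < (√y)⁻¹ - 1 := sub_pos.2 (one_lt_inv₀ hy |>.2 hy1)
      refine ⟨√((√y)⁻¹ - 1), Real.sqrt_pos.2 h2, ?_⟩
      simp only [hφ]
      rw [Real.sq_sqrt h2.le, add_sub_cancel, inv_pow, inv_inv, Real.sq_sqrt h0.le]
  have hsub := integral_image_eq_integral_abs_deriv_smul measurableSet_Ioi hder hinj
    (fun y => y ^ ((1 / 4 : ℝ) - 1) * (1 - y) ^ ((1 / 2 : ℝ) - 1))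
  rw [himg, integral_Ioo_beta (by norm_num) (by norm_num)] at hsub
  rw [show (1 / 4 + 1 / 2 : ℝ) = 3 / 4 by norm_num] at hsub
  rw [hsub, agmIntegral, integral_even_eq (by simp), ← integral_const_mul, ← integral_div]
  refine setIntegral_congr_fun measurableSet_Ioi fun t ht => ?_
  have ht : 0 < t := ht
  have hp : 0 < 1 + t ^ 2 := by positivity
  have e1 : φ t ^ ((1 / 4 : ℝ) - 1) = (1 + t ^ 2) * √(1 + t ^ 2) := by
    simp only [hφ]
    rw [← Real.rpow_natCast, ← Real.rpow_neg hp.le, ← Real.rpow_mul hp.le, Real.sqrt_eq_rpow]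
    nth_rewrite 2 [← Real.rpow_one (1 + t ^ 2)]
    rw [← Real.rpow_add hp]
    norm_num
  have e2 : (1 - φ t) ^ ((1 / 2 : ℝ) - 1) = (1 + t ^ 2) / (t * √(t ^ 2 + 2)) := by
    have h1 : 1 - φ t = (t * √(t ^ 2 + 2) / (1 + t ^ 2)) ^ 2 := by
      rw [div_pow, mul_pow, Real.sq_sqrt (by positivity)]
      simp only [hφ]
      field_simp
      ring
    have h2 : 0 < t * √(t ^ 2 + 2) / (1 + t ^ 2) := by positivity
    rw [h1, ← Real.rpow_natCast, ← Real.rpow_mul h2.le]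
    norm_num
    rw [Real.rpow_neg_one, inv_div]
  have e3 : |φ' t| = 4 * t * (1 + t ^ 2) / ((1 + t ^ 2) ^ 2) ^ 2 := by
    simp only [hφ']
    rw [neg_div, abs_neg, abs_of_pos (by positivity)]
  simp only [smul_eq_mul]
  rw [e1, e2, e3, Real.sq_sqrt (by norm_num), one_pow, Real.sqrt_mul (by positivity),
    add_comm (t ^ 2) 1]
  have hs : 0 < √(1 + t ^ 2) := by positivity
  have hs2 : 0 < √(t ^ 2 + 2) := by positivity
  have hq : √(1 + t ^ 2) ^ 2 = 1 + t ^ 2 := Real.sq_sqrt hp.le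
  field_simp
  rw [hq]
  ring

lemma agmIntegral_mul {a b c : ℝ} (hc : 0 < c) :
    agmIntegral (a * c) (b * c) = agmIntegral a b / c := by
  have h := Measure.integral_comp_mul_left
    (fun x : ℝ => 1 / √((x ^ 2 + (a * c) ^ 2) * (x ^ 2 + (b * c) ^ 2))) c
  rw [smul_eq_mul, abs_of_pos (by positivity)] at h
  have h2 : ∀ x : ℝ, 1 / √(((c * x) ^ 2 + (a * c) ^ 2) * ((c * x) ^ 2 + (b * c) ^ 2)) =
      (c ^ 2)⁻¹ * (1 / √((x ^ 2 + a ^ 2) * (x ^ 2 + b ^ 2))) := by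
    intro x
    rw [show ((c * x) ^ 2 + (a * c) ^ 2) * ((c * x) ^ 2 + (b * c) ^ 2) =
      (c ^ 2) ^ 2 * ((x ^ 2 + a ^ 2) * (x ^ 2 + b ^ 2)) by ring, Real.sqrt_mul (by positivity),
      Real.sqrt_sq (by positivity)]
    rw [one_div, mul_inv, one_div]
  simp_rw [h2] at h
  rw [integral_const_mul] at h
  rw [agmIntegral, agmIntegral]
  generalize (∫ x : ℝ, 1 / √((x ^ 2 + (a * c) ^ 2) * (x ^ 2 + (b * c) ^ 2))) = A at *
  field_simp at h ⊢
  linarith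

lemma Gamma_one_quarter_mul_Gamma_three_quarters :
    Real.Gamma (1 / 4) * Real.Gamma (3 / 4) = Real.pi * √2 := by
  have := Real.Gamma_mul_Gamma_one_sub (1 / 4)
  rw [show (1 - 1 / 4 : ℝ) = 3 / 4 by norm_num, show Real.pi * (1 / 4) = Real.pi / 4 by ring,
    Real.sin_pi_div_four] at this
  rw [this]
  have := Real.sq_sqrt (show (0:ℝ) ≤ 2 by norm_num)
  field_simp
  linarith

/-- The classical value `θ₃(i) = π^(1/4) / Γ(3/4)`. -/
lemma thetaThree_one : thetaThree 1 = Real.pi ^ (1 / 4 : ℝ) / Real.Gamma (3 / 4) := by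
  have hpi := Real.pi_pos
  have h3 := thetaThree_pos one_pos
  have h4 : thetaFour 1 ≠ 0 := by simpa using thetaFour_two_pow_ne_zero 0
  have hG : 0 < Real.Gamma (3 / 4) := Real.Gamma_pos_of_pos (by norm_num)
  have hrefl := Gamma_one_quarter_mul_Gamma_three_quarters
  have hI := agmIntegral_theta_one
  -- `(θ₃², θ₄²) = θ₄² (√2, 1)` at `y = 1`, and the integral is homogeneous of degree `-1`.
  have hmul := agmIntegral_mul (a := √2) (b := 1) (c := thetaFour 1 ^ 2) (by positivity)
  rw [← thetaThree_one_sq, one_mul, hI, agmIntegral_sqrt_two_one, Real.Gamma_one_half_eq] at hmul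
  have hsq : thetaThree 1 ^ 2 = (Real.pi ^ (1 / 4 : ℝ) / Real.Gamma (3 / 4)) ^ 2 := by
    have hp : (Real.pi ^ (1 / 4 : ℝ)) ^ 2 = √Real.pi := by
      rw [← Real.rpow_natCast, ← Real.rpow_mul hpi.le, Real.sqrt_eq_rpow]
      norm_num
    have hs2 := Real.sq_sqrt (show (0:ℝ) ≤ 2 by norm_num)
    rw [div_pow, hp, thetaThree_one_sq]
    have hb : thetaFour 1 ^ 2 * Real.pi =
        Real.Gamma (1 / 4) * √Real.pi / Real.Gamma (3 / 4) / 2 := by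
      rw [mul_comm]
      exact (eq_div_iff (by positivity)).1 hmul
    have hb' : thetaFour 1 ^ 2 * Real.pi * Real.Gamma (3 / 4) * 2 =
        Real.Gamma (1 / 4) * √Real.pi := by rw [hb]; field_simp
    rw [eq_div_iff (by positivity)]
    refine mul_left_cancel₀ hpi.ne' ?_
    have : Real.Gamma (3 / 4) * (thetaFour 1 ^ 2 * Real.pi * Real.Gamma (3 / 4) * 2) =
        Real.pi * √2 * √Real.pi := by rw [hb']; linear_combination √Real.pi * hrefl
    linear_combination √2 / 2 * this + Real.pi * √Real.pi / 2 * hs2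
  exact (sq_eq_sq₀ h3.le (by positivity)).1 hsq

/-! ### Partial fractions of the integrand of `J` -/

lemma pi_cpow_mul_zeta_mul_Gamma (v : ℝ) :
    riemannXi (1 + 2 * Complex.I * v) = 2 * Complex.I * v * (Real.pi *
      ((Real.pi : ℂ) ^ (-3 / 2 - Complex.I * v) * riemannZeta (1 + 2 * Complex.I * v) *
        Complex.Gamma (3 / 2 + Complex.I * v))) := by
  have hpi : (Real.pi : ℂ) ≠ 0 := by exact_mod_cast Real.pi_ne_zero
  have e1 : -(1 + 2 * Complex.I * v) / 2 = 1 + (-3 / 2 - Complex.I * v) := by ring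
  have e2 : 1 + (1 + 2 * Complex.I * v) / 2 = 3 / 2 + Complex.I * v := by ring
  rw [riemannXi, e1, e2, Complex.cpow_add _ _ hpi, Complex.cpow_one]
  ring

/-- Here `c + 5/4 = -1/4`, so `1 - (2s - 1)² = 4s(1 - s)` simplifies both parts of the transfer
function. -/
lemma integrandJ_neg_three_halves (s : ℂ) (v : ℝ) :
    integrandJ s (-3 / 2) v = (Real.pi : ℂ) ^ (-3 / 2 - Complex.I * v) *
      riemannZeta (1 + 2 * Complex.I * v) * Complex.Gamma (3 / 2 + Complex.I * v) *
      ((2 * s * (1 - s) + 2 * Complex.I * v) /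
        (s * (1 - s) + 2 * Complex.I * v - 4 * (v : ℂ) ^ 2)) := by
  rw [integrandJ, transferM]
  push_cast
  congr 1
  · ring_nf
  · congr 1
    · ring
    · linear_combination (4 * (v : ℂ) ^ 2) * Complex.I_sq

noncomputable section

/-- The integrable part of the integrand of `J(s, -3/2)`, as a function of `y = 2v`. -/
def regularJ (s : ℂ) (y : ℝ) : ℂ :=
  1 / Real.pi * (2 * regXi 1 (1 + y * Complex.I)
    - (regXi s (1 + y * Complex.I) + regXi (1 - s) (1 + y * Complex.I))
    - entireXi s * (poleKernel (1 + y * Complex.I - s) + poleKernel (1 + y * Complex.I - (1 - s))))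

end

lemma integral_poleKernel_sub {s : ℂ} (h0 : 0 < s.re) (h1 : s.re < 1) :
    Integrable (fun y : ℝ => poleKernel (1 + y * Complex.I - s)) ∧
      ∫ y : ℝ, poleKernel (1 + y * Complex.I - s) = Real.pi := by
  obtain ⟨i, e⟩ := integral_poleKernel (a := 1 - s.re) (by linarith) (by linarith)
  have h : ∀ y : ℝ, poleKernel (1 + y * Complex.I - s) =
      poleKernel ((1 - s.re : ℝ) + (y - s.im : ℝ) * Complex.I) := by
    intro y
    congr 1
    push_cast
    linear_combination Complex.re_add_im s
  simp_rw [h]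
  exact ⟨i.comp_sub_right s.im, by
    rw [integral_sub_right_eq_self (fun y : ℝ => poleKernel ((1 - s.re : ℝ) + y * Complex.I)), e]⟩

/-- The term at `1` gives `θ₃(1) - 1`, the symmetrized pair gives `0`, and the two kernels give
`-2ξ(s)`. -/
lemma integral_regularJ {s : ℂ} (h0 : 0 < s.re) (h1 : s.re < 1) :
    Integrable (regularJ s) ∧ ∫ y, regularJ s y = thetaThree 1 - 1 - 2 * entireXi s := by
  obtain ⟨i1, e1⟩ := integral_regXi_one
  obtain ⟨i2, i3, e2⟩ := integral_regXi_add_regXi_one_sub h0 h1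
  obtain ⟨i4, e4⟩ := integral_poleKernel_sub h0 h1
  obtain ⟨i5, e5⟩ := integral_poleKernel_sub (s := 1 - s) (by simpa using h1) (by simpa using h0)
  have j23 : Integrable fun y : ℝ =>
    regXi s (1 + y * Complex.I) + regXi (1 - s) (1 + y * Complex.I) := i2.add i3
  have j45 : Integrable fun y : ℝ => entireXi s * (poleKernel (1 + y * Complex.I - s) +
    poleKernel (1 + y * Complex.I - (1 - s))) := (i4.add i5).const_mul _
  have j1 : Integrable fun y : ℝ => 2 * regXi 1 (1 + y * Complex.I) := i1.const_mul 2
  have j123 : Integrable fun y : ℝ => 2 * regXi 1 (1 + y * Complex.I) -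
    (regXi s (1 + y * Complex.I) + regXi (1 - s) (1 + y * Complex.I)) := j1.sub j23
  refine ⟨(j123.sub j45).const_mul _, ?_⟩
  have : ∫ y, regularJ s y = 1 / Real.pi * (2 * (∫ y : ℝ, regXi 1 (1 + y * Complex.I))
      - ((∫ y : ℝ, regXi s (1 + y * Complex.I)) + ∫ y : ℝ, regXi (1 - s) (1 + y * Complex.I))
      - entireXi s * ((∫ y : ℝ, poleKernel (1 + y * Complex.I - s)) +
        ∫ y : ℝ, poleKernel (1 + y * Complex.I - (1 - s)))) := by
    rw [← integral_add i2 i3, ← integral_add i4 i5, ← integral_const_mul, ← integral_const_mul,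
      ← integral_sub j1 j23, ← integral_sub j123 j45, ← integral_const_mul]
    rfl
  have hpi : (Real.pi : ℂ) ≠ 0 := by exact_mod_cast Real.pi_ne_zero
  rw [this, e1, e2, e4, e5, integral_entireXi_div]
  field_simp
  ring

lemma integral_regularJ_comp {s : ℂ} (h0 : 0 < s.re) (h1 : s.re < 1) :
    Integrable (fun v : ℝ => regularJ s (2 * v)) ∧
      ∫ v : ℝ, regularJ s (2 * v) = ((thetaThree 1 / 2 - 1 / 2 : ℝ) : ℂ) - entireXi s := by
  obtain ⟨i, e⟩ := integral_regularJ h0 h1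
  refine ⟨i.comp_mul_left' two_ne_zero, ?_⟩
  rw [Measure.integral_comp_mul_left, e, abs_of_pos (by norm_num), Complex.real_smul]
  push_cast
  ring

/-- The partial fraction coefficients at `1`, `s`, `1 - s` are `2`, `-1`, `-1`. Since `2 ξ(1) = 1`,
the kernel at `1` appears with coefficient `1/π`. -/
lemma integrandJ_eq {s : ℂ} (h0 : 0 < s.re) (h1 : s.re < 1) {v : ℝ} (hv : v ≠ 0) :
    integrandJ s (-3 / 2) v =
      regularJ s (2 * v) + 1 / Real.pi * poleKernel (2 * Complex.I * v) := by
  have hpi : (Real.pi : ℂ) ≠ 0 := by exact_mod_cast Real.pi_ne_zero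
  have hv' : (v : ℂ) ≠ 0 := by exact_mod_cast hv
  have hw1 : (1 + (2 * v : ℝ) * Complex.I : ℂ) = 1 + 2 * Complex.I * v := by push_cast; ring
  set w : ℂ := 1 + 2 * Complex.I * v with hw
  have hre : w.re = 1 := by simp [hw]
  have hiv : 2 * Complex.I * v = w - 1 := by rw [hw]; ring
  have n1 : w - 1 ≠ 0 := by rw [← hiv]; simp [hv]
  have ns : w ≠ s := fun h => by rw [← h] at h1; linarith
  have ns' : w ≠ 1 - s := fun h => by rw [h] at hre; simp at hre; linarith
  have n2 : w - s ≠ 0 := sub_ne_zero.2 ns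
  have n3 : w - (1 - s) ≠ 0 := sub_ne_zero.2 ns'
  have hX := pi_cpow_mul_zeta_mul_Gamma v
  rw [← hw, riemannXi_eq_entireXi (by rw [hre]; exact one_pos) (sub_ne_zero.1 n1), hiv] at hX
  rw [integrandJ_neg_three_halves, regularJ, hw1, regXi_eq (sub_ne_zero.1 n1), regXi_eq ns,
    regXi_eq ns', entireXi_one_sub, entireXi_one, hX]
  have hden : s * (1 - s) + 2 * Complex.I * v - 4 * (v : ℂ) ^ 2 = (w - s) * (w - (1 - s)) := by
    rw [hw]; linear_combination (-4 * (v : ℂ) ^ 2) * Complex.I_sq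
  rw [hden, ← hw, hiv]
  generalize (Real.pi : ℂ) ^ (-3 / 2 - Complex.I * v) * riemannZeta w *
    Complex.Gamma (3 / 2 + Complex.I * v) = Q
  field_simp
  ring

/-! ### Principal value and real part at the fixed pole -/

lemma poleKernel_two_I_mul (v : ℝ) :
    poleKernel (2 * Complex.I * v) = -Complex.I * ((1 / (2 * v * (1 + 4 * v ^ 2)) : ℝ) : ℂ) := by
  have h : (1 - (2 * Complex.I * v) ^ 2 : ℂ) = 1 + 4 * (v : ℂ) ^ 2 := by
    linear_combination (-4 * (v : ℂ) ^ 2) * Complex.I_sq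
  rw [poleKernel, h]
  push_cast
  rw [one_div, one_div, mul_inv, mul_inv, mul_inv, Complex.inv_I, mul_inv, mul_inv]
  ring

lemma integrableOn_poleKernel {ε : ℝ} (hε : 0 < ε) :
    IntegrableOn (fun v : ℝ => poleKernel (2 * Complex.I * v)) {v : ℝ | ε < |v|} := by
  have hmeas : MeasurableSet {v : ℝ | ε < |v|} :=
    measurableSet_lt measurable_const measurable_id.abs
  refine ((integrable_inv_one_add_sq.const_mul (1 / (2 * ε))).integrableOn).mono' ?_ ?_
  · simp_rw [poleKernel_two_I_mul]
    exact (Measurable.aestronglyMeasurable (by fun_prop))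
  · filter_upwards [ae_restrict_mem hmeas] with v hv
    have hv : ε < |v| := hv
    rw [poleKernel_two_I_mul, norm_mul, norm_neg, Complex.norm_I, one_mul, Complex.norm_real,
      norm_div, norm_one, norm_mul, norm_mul, Real.norm_eq_abs, Real.norm_eq_abs, Real.norm_eq_abs,
      abs_two, abs_of_pos (by positivity : 0 < 1 + 4 * v ^ 2), ← one_div, one_div_mul_one_div]
    refine one_div_le_one_div_of_le (by positivity) ?_
    gcongr
    linarith [sq_nonneg v]

lemma setIntegral_poleKernel (ε : ℝ) :
    ∫ v : ℝ in {v : ℝ | ε < |v|}, poleKernel (2 * Complex.I * v) = 0 := by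
  have hmeas : MeasurableSet {v : ℝ | ε < |v|} :=
    measurableSet_lt measurable_const measurable_id.abs
  rw [← integral_indicator hmeas]
  set F := Set.indicator {v : ℝ | ε < |v|} fun v : ℝ => poleKernel (2 * Complex.I * v)
  have hodd : ∀ v, F (-v) = -F v := by
    intro v
    by_cases h : ε < |v|
    · have h1 : v ∈ {v : ℝ | ε < |v|} := h
      have h2 : -v ∈ {v : ℝ | ε < |v|} := by change ε < |-v|; rwa [abs_neg]
      simp only [F]
      rw [Set.indicator_of_mem h1, Set.indicator_of_mem h2, ← poleKernel_neg]
      push_cast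
      ring_nf
    · have h1 : v ∉ {v : ℝ | ε < |v|} := h
      have h2 : -v ∉ {v : ℝ | ε < |v|} := by change ¬ ε < |-v|; rwa [abs_neg]
      simp only [F]
      rw [Set.indicator_of_notMem h1, Set.indicator_of_notMem h2, neg_zero]
  have h := integral_neg_eq_self F volume
  simp_rw [hodd] at h
  rw [integral_neg] at h
  exact self_eq_neg.1 h.symm

lemma tendsto_setIntegral_lt_abs {N : ℝ → ℂ} (hN : Integrable N) :
    Tendsto (fun ε : ℝ => ∫ v in {v : ℝ | ε < |v|}, N v) (𝓝[>] 0) (𝓝 (∫ v, N v)) := by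
  have hmeas : ∀ ε : ℝ, MeasurableSet {v : ℝ | ε < |v|} := fun ε =>
    measurableSet_lt measurable_const measurable_id.abs
  simp_rw [← integral_indicator (hmeas _)]
  refine tendsto_integral_filter_of_dominated_convergence (fun v => ‖N v‖)
    (Eventually.of_forall fun ε => hN.aestronglyMeasurable.indicator (hmeas ε))
    (Eventually.of_forall fun ε => ae_of_all _ fun v => norm_indicator_le_norm_self _ _) hN.norm ?_
  filter_upwards [Measure.ae_ne volume (0 : ℝ)] with v hv
  refine tendsto_const_nhds.congr' ?_
  filter_upwards [nhdsWithin_le_nhds (eventually_lt_nhds (abs_pos.2 hv))] with ε hε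
  exact (Set.indicator_of_mem (show v ∈ {v : ℝ | ε < |v|} from hε) N).symm

lemma hasHalfResidueJ_of_mem_strip {s : ℂ} (h0 : 0 < s.re) (h1 : s.re < 1) :
    HasHalfResidueJ s (((thetaThree 1 / 2 - 1 / 2 : ℝ) : ℂ) - entireXi s) := by
  obtain ⟨i, e⟩ := integral_regularJ_comp h0 h1
  have hmeas : ∀ ε : ℝ, MeasurableSet {v : ℝ | ε < |v|} := fun ε =>
    measurableSet_lt measurable_const measurable_id.abs
  have hcongr : ∀ ε : ℝ, 0 < ε → Set.EqOn (integrandJ s (-3 / 2))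
      (fun v => regularJ s (2 * v) + 1 / Real.pi * poleKernel (2 * Complex.I * v))
      {v : ℝ | ε < |v|} := fun ε hε v hv =>
    integrandJ_eq h0 h1 (abs_pos.1 (hε.trans hv))
  refine ⟨fun ε hε => ?_, ?_⟩
  · exact IntegrableOn.congr_fun (i.integrableOn.add ((integrableOn_poleKernel hε).const_mul _))
      (hcongr ε hε).symm (hmeas ε)
  · rw [← e]
    refine (tendsto_setIntegral_lt_abs i).congr' ?_
    filter_upwards [self_mem_nhdsWithin] with ε hε
    rw [setIntegral_congr_fun (hmeas ε) (hcongr ε hε), integral_add i.integrableOn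
      ((integrableOn_poleKernel hε).const_mul _), integral_const_mul, setIntegral_poleKernel,
      mul_zero, add_zero]

/-- The singular part is purely imaginary, so the real part agrees almost everywhere with that of an
integrable function. -/
lemma integral_re_integrandJ {s : ℂ} (h0 : 0 < s.re) (h1 : s.re < 1) :
    Integrable (fun v => (integrandJ s (-3 / 2) v).re) ∧
      ∫ v, (integrandJ s (-3 / 2) v).re =
        (((thetaThree 1 / 2 - 1 / 2 : ℝ) : ℂ) - entireXi s).re := by
  obtain ⟨i, e⟩ := integral_regularJ_comp h0 h1
  have hae : (fun v : ℝ => (regularJ s (2 * v)).re) =ᵐ[volume]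
      fun v => (integrandJ s (-3 / 2) v).re := by
    filter_upwards [Measure.ae_ne volume (0 : ℝ)] with v hv
    rw [integrandJ_eq h0 h1 hv, poleKernel_two_I_mul, Complex.add_re, left_eq_add]
    rw [show (1 / Real.pi : ℂ) = ((1 / Real.pi : ℝ) : ℂ) by push_cast; rfl, Complex.re_ofReal_mul,
      neg_mul, Complex.neg_re, Complex.I_mul_re, Complex.ofReal_im]
    simp
  refine ⟨i.re.congr hae, ?_⟩
  rw [← integral_congr_ae hae, ← e]
  exact integral_re i

/-! ### Specialization to the critical line and to `s = 1/2` -/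

lemma riemannXi_conj (s : ℂ) :
    riemannXi ((starRingEnd ℂ) s) = (starRingEnd ℂ) (riemannXi s) := by
  have harg : (Real.pi : ℂ).arg ≠ Real.pi := by
    rw [Complex.arg_ofReal_of_nonneg Real.pi_pos.le]; exact Real.pi_ne_zero.symm
  have h1 : (Real.pi : ℂ) ^ (-(starRingEnd ℂ) s / 2) =
      (starRingEnd ℂ) ((Real.pi : ℂ) ^ (-s / 2)) := by
    rw [show -(starRingEnd ℂ) s / 2 = (starRingEnd ℂ) (-s / 2) by simp [map_ofNat],
      Complex.cpow_conj _ _ harg, Complex.conj_ofReal]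
  have h2 : Complex.Gamma (1 + (starRingEnd ℂ) s / 2) =
      (starRingEnd ℂ) (Complex.Gamma (1 + s / 2)) := by
    rw [← Complex.Gamma_conj]; simp [map_ofNat]
  rw [riemannXi, riemannXi, h1, h2, riemannZeta_conj]
  simp

/-- On this line conjugation coincides with `s ↦ 1 - s`, under which `ξ` is invariant. -/
lemma entireXi_critical_line_im (t : ℝ) : (entireXi (1 / 2 + Complex.I * t)).im = 0 := by
  have hre : (1 / 2 + Complex.I * t : ℂ).re = 1 / 2 := by simp
  have hne : (1 / 2 + Complex.I * t : ℂ) ≠ 1 := fun h => by rw [h] at hre; norm_num at hre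
  have hX := riemannXi_eq_entireXi (by rw [hre]; norm_num) hne
  have hconj : (starRingEnd ℂ) (1 / 2 + Complex.I * t) = 1 - (1 / 2 + Complex.I * t) := by
    simp only [map_add, map_div₀, map_one, map_mul, Complex.conj_I, Complex.conj_ofReal,
      map_ofNat]
    ring
  have hre' : (1 - (1 / 2 + Complex.I * t) : ℂ).re = 1 / 2 := by simp; norm_num
  have hne' : (1 - (1 / 2 + Complex.I * t) : ℂ) ≠ 1 := fun h => by
    rw [h] at hre'; norm_num at hre'
  have h := riemannXi_conj (1 / 2 + Complex.I * t)
  rw [hconj, riemannXi_eq_entireXi (by rw [hre']; norm_num) hne', entireXi_one_sub, hX] at h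
  exact Complex.conj_eq_iff_im.1 h.symm

/-- At `s = 1/2` the denominator is the square of the numerator `2iv + 1/2`. -/
lemma zetaIntegrand_eq (v : ℝ) : zetaIntegrand v = (integrandJ (1 / 2) (-3 / 2) v).re := by
  rw [zetaIntegrand, integrandJ_neg_three_halves]
  congr 1
  have hne : (2 * Complex.I * v + 1 / 2 : ℂ) ≠ 0 := fun h => by
    have := congrArg Complex.re h
    norm_num at this
  have hden : (1 / 2 * (1 - 1 / 2) + 2 * Complex.I * v - 4 * (v : ℂ) ^ 2 : ℂ) =
      (2 * Complex.I * v + 1 / 2) * (2 * Complex.I * v + 1 / 2) := by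
    linear_combination (-4 * (v : ℂ) ^ 2) * Complex.I_sq
  have hnum : (2 * (1 / 2) * (1 - 1 / 2) + 2 * Complex.I * v : ℂ) =
      2 * Complex.I * v + 1 / 2 := by ring
  rw [hden, hnum, div_mul_cancel_left₀ hne, div_eq_mul_inv]

/-- The factor `w - 1 = 2iv` of `ξ(w)` cancels `v` and leaves an `i`, which turns the imaginary part
into a real part. -/
lemma xiIntegrand_eq {v : ℝ} (hv : v ≠ 0) :
    xiIntegrand v = 2 * Real.pi * zetaIntegrand v := by
  have hv' : (v : ℂ) ≠ 0 := by exact_mod_cast hv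
  rw [xiIntegrand, zetaIntegrand, pi_cpow_mul_zeta_mul_Gamma]
  generalize (Real.pi : ℂ) ^ (-3 / 2 - Complex.I * v) * riemannZeta (1 + 2 * Complex.I * v) *
        Complex.Gamma (3 / 2 + Complex.I * v) = Q
  have : 2 * Complex.I * v * (Real.pi * Q) / ((2 * Complex.I * v + 1 / 2) * v) =
      ((2 * Real.pi : ℝ) : ℂ) * (Complex.I * (Q / (2 * Complex.I * v + 1 / 2))) := by
    rw [mul_comm (2 * Complex.I * v + 1 / 2) (v : ℂ), mul_div_assoc', mul_div_assoc',
      show 2 * Complex.I * v * (Real.pi * Q) = v * (2 * Real.pi * (Complex.I * Q)) by ring,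
      mul_div_mul_left _ _ hv']
    push_cast
    rfl
  rw [this, Complex.im_ofReal_mul, Complex.I_mul_im]

/-- Here `s(1 - s) = t² + 1/4`; the `2` comes from the numerator and `π^(3/2)` from the power of
`π`. -/
lemma criticalIntegrand_eq (t v : ℝ) : criticalIntegrand t v =
    2 * Real.pi ^ (3 / 2 : ℝ) * (integrandJ (1 / 2 + Complex.I * t) (-3 / 2) v).re := by
  have hpi : (Real.pi : ℂ) ≠ 0 := by exact_mod_cast Real.pi_ne_zero
  have e1 : (Real.pi : ℂ) ^ (-(Complex.I * v)) =
      ((Real.pi ^ (3 / 2 : ℝ) : ℝ) : ℂ) * (Real.pi : ℂ) ^ (-3 / 2 - Complex.I * v) := by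
    rw [Complex.ofReal_cpow Real.pi_pos.le, ← Complex.cpow_add _ _ hpi]
    push_cast
    ring_nf
  have e2 : (1 / 2 + Complex.I * t) * (1 - (1 / 2 + Complex.I * t)) + 2 * Complex.I * v
      - 4 * (v : ℂ) ^ 2 = (t : ℂ) ^ 2 + 2 * Complex.I * v - 4 * (v : ℂ) ^ 2 + 1 / 4 := by
    linear_combination (-(t : ℂ) ^ 2) * Complex.I_sq
  have e3 : 4 * (t : ℂ) ^ 2 + 4 * Complex.I * v + 1 = 2 * (2 * (1 / 2 + Complex.I * t) *
      (1 - (1 / 2 + Complex.I * t)) + 2 * Complex.I * v) := by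
    linear_combination (4 * (t : ℂ) ^ 2) * Complex.I_sq
  rw [criticalIntegrand, integrandJ_neg_three_halves, ← Complex.re_ofReal_mul, e1, e2, e3]
  congr 1
  push_cast
  ring

lemma thetaThree_one_div_two :
    thetaThree 1 / 2 = Real.pi ^ (1 / 4 : ℝ) / (2 * Real.Gamma (3 / 4)) := by
  rw [thetaThree_one, div_div, mul_comm]

/-- `Γ(5/4) = Γ(1/4)/4`, and reflection replaces `Γ(1/4)` by `π√2/Γ(3/4)`. -/
lemma riemannXi_one_half : riemannXi (1 / 2) =
    -(riemannZeta (1 / 2) * ((Real.pi ^ (3 / 4 : ℝ) * √2 / (8 * Real.Gamma (3 / 4)) : ℝ) : ℂ)) := by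
  have hG : 0 < Real.Gamma (3 / 4) := Real.Gamma_pos_of_pos (by norm_num)
  have e1 : Complex.Gamma (1 + 1 / 2 / 2) = ((Real.Gamma (1 / 4) / 4 : ℝ) : ℂ) := by
    have : (1 + 1 / 2 / 2 : ℂ) = ((1 / 4 + 1 : ℝ) : ℂ) := by push_cast; norm_num
    rw [this, Complex.Gamma_ofReal, Real.Gamma_add_one (by norm_num)]
    ring_nf
  have e2 : (Real.pi : ℂ) ^ (-(1 / 2) / 2 : ℂ) = ((Real.pi ^ (-(1 / 4) : ℝ) : ℝ) : ℂ) := by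
    rw [Complex.ofReal_cpow Real.pi_pos.le]
    push_cast
    norm_num
  have e3 : Real.pi ^ (-(1 / 4) : ℝ) * (Real.Gamma (1 / 4) / 4) =
      Real.pi ^ (3 / 4 : ℝ) * √2 / (4 * Real.Gamma (3 / 4)) := by
    have h1 : Real.pi ^ (3 / 4 : ℝ) = Real.pi ^ (-(1 / 4) : ℝ) * Real.pi := by
      nth_rewrite 3 [← Real.rpow_one Real.pi]
      rw [← Real.rpow_add Real.pi_pos]
      norm_num
    rw [h1, mul_assoc, ← Gamma_one_quarter_mul_Gamma_three_quarters]
    field_simp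
  rw [riemannXi, e1, e2]
  have e4 := congrArg (fun x : ℝ => (x : ℂ)) e3
  push_cast at e4 ⊢
  linear_combination (-(1 / 2) * riemannZeta (1 / 2)) * e4

theorem mainTheorem4 :
    -- the line `c = -3/2`, with half the residue of the fixed pole
    (∀ s : ℂ, 0 < s.re → s.re < 1 →
      HasHalfResidueJ s
        (((Real.pi ^ (1 / 4 : ℝ) / (2 * Real.Gamma (3 / 4)) - 1 / 2 : ℝ) : ℂ) - riemannXi s)) ∧
    -- the evaluation at `s = 1/2`
    (Integrable xiIntegrand ∧ Integrable zetaIntegrand ∧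
      1 / (2 * Real.pi) * (∫ v : ℝ, xiIntegrand v) = ∫ v : ℝ, zetaIntegrand v ∧
      ((∫ v : ℝ, zetaIntegrand v : ℝ) : ℂ) =
        riemannZeta (1 / 2) *
            ((Real.pi ^ (3 / 4 : ℝ) * √2 / (8 * Real.Gamma (3 / 4)) : ℝ) : ℂ)
          + ((Real.pi ^ (1 / 4 : ℝ) / (2 * Real.Gamma (3 / 4)) : ℝ) : ℂ) - 1 / 2) ∧
    -- the representation on the critical line
    (∀ t : ℝ, Integrable (criticalIntegrand t) ∧
      riemannXi (1 / 2 + Complex.I * t) =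
        ((-(1 / (2 * Real.pi ^ (3 / 2 : ℝ))) * (∫ v : ℝ, criticalIntegrand t v) - 1 / 2
          + Real.pi ^ (1 / 4 : ℝ) / (2 * Real.Gamma (3 / 4)) : ℝ) : ℂ)) := by
  have hpi := Real.pi_pos
  rw [← thetaThree_one_div_two]
  have hline : ∀ t : ℝ, (1 / 2 + Complex.I * t : ℂ).re = 1 / 2 := fun t => by simp
  have hX : ∀ s : ℂ, 0 < s.re → s.re < 1 → riemannXi s = entireXi s := fun s h0 h1 =>
    riemannXi_eq_entireXi h0 fun h => by rw [h] at h1; simp at h1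
  have hreal : ∀ t : ℝ, entireXi (1 / 2 + Complex.I * t) =
      ((entireXi (1 / 2 + Complex.I * t)).re : ℂ) := fun t => by
    refine Complex.ext (Complex.ofReal_re _).symm ?_
    rw [entireXi_critical_line_im, Complex.ofReal_im]
  have hJ : ∀ t : ℝ, Integrable (fun v => (integrandJ (1 / 2 + Complex.I * t) (-3 / 2) v).re) ∧
      ((∫ v, (integrandJ (1 / 2 + Complex.I * t) (-3 / 2) v).re : ℝ) : ℂ) =
        ((thetaThree 1 / 2 - 1 / 2 : ℝ) : ℂ) - entireXi (1 / 2 + Complex.I * t) := by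
    intro t
    obtain ⟨i, e⟩ := integral_re_integrandJ (s := 1 / 2 + Complex.I * t)
      (by rw [hline]; norm_num) (by rw [hline]; norm_num)
    refine ⟨i, ?_⟩
    rw [e, Complex.sub_re, Complex.ofReal_re, Complex.ofReal_sub, ← hreal]
  refine ⟨fun s h0 h1 => ?_, ?_, fun t => ?_⟩
  · rw [hX s h0 h1]
    exact hasHalfResidueJ_of_mem_strip h0 h1
  · have hJ0 := hJ 0
    rw [Complex.ofReal_zero, mul_zero, add_zero] at hJ0
    obtain ⟨i, e⟩ := hJ0
    simp_rw [← zetaIntegrand_eq] at i e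
    have hxi : (fun v => 2 * Real.pi * zetaIntegrand v) =ᵐ[volume] xiIntegrand := by
      filter_upwards [Measure.ae_ne volume (0 : ℝ)] with v hv
      exact (xiIntegrand_eq hv).symm
    refine ⟨(i.const_mul _).congr hxi, i, ?_, ?_⟩
    · rw [← integral_congr_ae hxi, integral_const_mul]
      field_simp
    · rw [e, ← hX _ (by norm_num) (by norm_num), riemannXi_one_half, Complex.ofReal_sub]
      push_cast
      ring
  · obtain ⟨i, e⟩ := hJ t
    have hc : criticalIntegrand t = fun v =>
        2 * Real.pi ^ (3 / 2 : ℝ) * (integrandJ (1 / 2 + Complex.I * t) (-3 / 2) v).re :=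
      funext fun v => criticalIntegrand_eq t v
    refine ⟨hc ▸ i.const_mul _, ?_⟩
    have hp : 0 < Real.pi ^ (3 / 2 : ℝ) := by positivity
    have hval : -(1 / (2 * Real.pi ^ (3 / 2 : ℝ))) * (∫ v : ℝ, criticalIntegrand t v) =
        -∫ v, (integrandJ (1 / 2 + Complex.I * t) (-3 / 2) v).re := by
      rw [hc, integral_const_mul]
      field_simp
    rw [hX _ (by rw [hline]; norm_num) (by rw [hline]; norm_num), hval]
    push_cast at e ⊢
    rw [e]
    ring
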